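/- Let $F_0$ be the distribution function of the uniform distribution on $[0,1/4]\cup[3/4,1]$ and $F_0^{-1}(q)=\inf\{v\in[0,1]: F_0(v)\ge q\}$ for $q\in[0,1]$. Candidates with i.i.d. abilities $\theta_1,\dots,\theta_T\sim F_0$ arrive one at a time; each must be irrevocably hired or rejected on arrival, and at most $B$ may be hired, where $1\le B\le T$. The regret $\mathrm{Regret}(B,T;\pi)$ of a policy $\pi$ is the expected sum of the $B$ largest abilities minus the expected sum of the abilities hired by $\pi$. Let $B_0=B$ and let $B_t$ be the remaining budget after time $t$. The certainty equivalent policy CE hires at time $t$ iff $F_0(\theta_t)\ge p^{ce}_{t-1}:=1-\frac{B_{t-1}}{T-t+1}$. The policy CwG (conservative with respect to gaps) for $F_0$, with its single gap $(1/4,3/4)$, gap quantile $q^\star_1=F_0(1/4)=1/2$ and cluster size $\varepsilon_0=1/2$, is as follows. Let $\tilde T=\max\{0,\,T-\lfloor 16\log(1/\varepsilon_0)/\varepsilon_0^2\rfloor\}$. At time $t$ let $X_t$ be a uniform sample from $\{q\in[0,1]:F_0^{-1}(q)=\theta_t\}$ (almost surely a single point, so $X_t=F_0(\theta_t)$). The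 candidate is hired iff $B_{t-1}>0$ and $X_t\ge p_{t-1}$, where, for $t\le\tilde T$, $p_{t-1}=q^\star_1$ if $|p^{ce}_{t-1}-q^\star_1|<\sqrt{2\log(T-t+1)/(T-t+1)}$ and $p_{t-1}=p^{ce}_{t-1}$ otherwise, and, for $t>\tilde T$, $p_{t-1}=1-\frac{B_{\tilde T}}{T-\tilde T}$. Then there is a constant $C<\infty$ such that for all $T\in\mathbb N$ and all $B\in\{1,\dots,T\}$, $$\mathrm{Regret}(B,T;\mathrm{CwG})\le C(\log T)^2 .$$ In contrast, there are $c>0$ and $T_0$ such that for every $T\ge T_0$ there is $B\in\{1,\dots,T\}$ with $\mathrm{Regret}(B,T;\mathrm{CE})\ge c\sqrt T$. -/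

import Mathlib

open MeasureTheory ProbabilityTheory Set

/-- Candidate abilities `θ 0, θ 1, …` (the candidate at time `t + 1` has ability `θ t`), i.i.d. with
law `μ`, together with i.i.d. `Uniform[0,1]` variables `U 0, U 1, …` available for randomization;
all these variables are mutually independent. -/
structure IsCandidateSequence {Ω : Type*} [MeasurableSpace Ω] (P : Measure Ω) (μ : Measure ℝ)
    (θ U : ℕ → Ω → ℝ) : Prop where
  measurable_ability : ∀ t, Measurable (θ t)
  measurable_unif : ∀ t, Measurable (U t)
  law_ability : ∀ t, P.map (θ t) = μ
  law_unif : ∀ t, P.map (U t) = (volume : Measure ℝ).restrict (Icc 0 1)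
  indep : iIndepFun (Sum.elim θ U) P

/-- A hiring rule along a fixed sample path: `rule t b` says that the candidate presented at time
`t + 1` is hired when the remaining budget is `b`. -/
abbrev HiringRule := ℕ → ℤ → Prop

open Classical in
/-- The remaining budget `B_t` after `t` candidates, starting from `B_0 = B`. -/
noncomputable def remainingBudget (B : ℕ) (rule : HiringRule) : ℕ → ℤ
  | 0 => B
  | t + 1 =>
    if rule t (remainingBudget B rule t) then remainingBudget B rule t - 1
    else remainingBudget B rule t

open Classical in
/-- Total ability of the candidates hired during the `T` periods. -/
noncomputable def onlineValue (x : ℕ → ℝ) (T B : ℕ) (rule : HiringRule) : ℝ :=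
  ∑ t ∈ Finset.range T, if rule t (remainingBudget B rule t) then x t else 0

/-- The hindsight optimum: the largest total ability of at most `B` of the `T` candidates. -/
noncomputable def offlineValue (x : ℕ → ℝ) (T B : ℕ) : ℝ :=
  ((Finset.range T).powerset.filter (fun s => s.card ≤ B)).sup' ⟨∅, by simp⟩
    (fun s => ∑ t ∈ s, x t)

/-- Expected hindsight optimum minus the expected total ability hired by a policy. -/
noncomputable def regret {Ω : Type*} [MeasurableSpace Ω] (P : Measure Ω) (θ : ℕ → Ω → ℝ)
    (T B : ℕ) (policy : Ω → HiringRule) : ℝ :=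
  (∫ ω, offlineValue (fun t => θ t ω) T B ∂P)
    - ∫ ω, onlineValue (fun t => θ t ω) T B (policy ω) ∂P

/-- The certainty-equivalent quantile `1 - b / (T - t)` after `t` periods with remaining budget
`b`. -/
noncomputable def ceQuantile (T t : ℕ) (b : ℤ) : ℝ := 1 - (b : ℝ) / ((T : ℝ) - (t : ℝ))

/-- The certainty equivalent policy for the ability distribution `μ`, along the ability path `x`. -/
noncomputable def cePolicy (μ : Measure ℝ) (T : ℕ) (x : ℕ → ℝ) : HiringRule :=
  fun t b => ceQuantile T t b ≤ cdf μ (x t)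

/-- The generalized inverse of the distribution function of a law supported in `[0,1]`. -/
noncomputable def quantileFn (μ : Measure ℝ) (q : ℝ) : ℝ := sInf {v ∈ Icc (0 : ℝ) 1 | q ≤ cdf μ v}

/-- The set of quantiles in `[0,1]` of the ability value `x`; it is an interval. -/
def quantileSet (μ : Measure ℝ) (x : ℝ) : Set ℝ := {q ∈ Icc (0 : ℝ) 1 | quantileFn μ q = x}

/-- A uniform sample from the interval `quantileSet μ x`, made from a `Uniform[0,1]` variable `u`.
If that interval is a single point, the sample is that point. -/
noncomputable def quantileSample (μ : Measure ℝ) (x u : ℝ) : ℝ :=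
  sInf (quantileSet μ x) + u * (sSup (quantileSet μ x) - sInf (quantileSet μ x))

open Classical in
/-- The indices of the gap quantiles that are within `√(2 log (T - t) / (T - t))` of the
certainty-equivalent quantile. -/
noncomputable def nearGaps {n : ℕ} (q : Fin n → ℝ) (T t : ℕ) (b : ℤ) : Finset (Fin n) :=
  Finset.univ.filter fun i => ceQuantile T t b ∈
    Metric.ball (q i) (√(2 * (Real.log ((T : ℝ) - (t : ℝ)) / ((T : ℝ) - (t : ℝ)))))

open Classical in
/-- The threshold quantile that is conservative with respect to gaps: a nearest gap quantile if some
gap quantile is near, and the certainty-equivalent quantile otherwise. -/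
noncomputable def cwgQuantile {n : ℕ} (q : Fin n → ℝ) (T t : ℕ) (b : ℤ) : ℝ :=
  if h : (nearGaps q T t b).Nonempty then
    q (Classical.choose ((nearGaps q T t b).exists_min_image (fun i => |ceQuantile T t b - q i|) h))
  else ceQuantile T t b

/-- The length of the first phase, `max {0, T - ⌊16 log (1 / ε₀) / ε₀²⌋}`. -/
noncomputable def firstPhase (ε₀ : ℝ) (T : ℕ) : ℕ := T - ⌊16 * Real.log (1 / ε₀) / ε₀ ^ 2⌋₊

/-- Hire when the quantile sample reaches the threshold and some budget is left. -/
def thresholdRule (X : ℕ → ℝ) (p : ℕ → ℤ → ℝ) : HiringRule := fun t b => p t b ≤ X t ∧ 0 < b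

/-- The budget left at the end of the first phase of the CwG policy. -/
noncomputable def firstPhaseBudget {n : ℕ} (q : Fin n → ℝ) (ε₀ : ℝ) (T B : ℕ) (X : ℕ → ℝ) : ℤ :=
  remainingBudget B (thresholdRule X (cwgQuantile q T)) (firstPhase ε₀ T)

open Classical in
/-- The policy "conservative with respect to gaps" (CwG) for the ability distribution `μ` with gaps
`(gap i).1 < (gap i).2` and cluster size parameter `ε₀`, along the ability path `x` and the
randomization path `u`. In the first phase the threshold quantile is the conservative one; in the
second phase it is the certainty-equivalent quantile computed at the end of the first phase. -/
noncomputable def cwgPolicy (μ : Measure ℝ) {n : ℕ} (gap : Fin n → ℝ × ℝ) (ε₀ : ℝ) (T B : ℕ)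
    (x u : ℕ → ℝ) : HiringRule :=
  let q : Fin n → ℝ := fun i => cdf μ (gap i).1
  let X : ℕ → ℝ := fun t => quantileSample μ (x t) (u t)
  thresholdRule X fun t b =>
    if t < firstPhase ε₀ T then cwgQuantile q T t b
    else ceQuantile T (firstPhase ε₀ T) (firstPhaseBudget q ε₀ T B X)

/-- The uniform distribution on `[0, 1/4] ∪ [3/4, 1]`. -/
noncomputable def gapUniform : Measure ℝ :=
  ProbabilityTheory.cond (volume : Measure ℝ) (Icc 0 (1 / 4) ∪ Icc (3 / 4) 1)

/-- The CwG policy for `gapUniform`, which has the single gap `(1/4, 3/4)`, with gap quantile `1/2`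
and two clusters of mass `1/2` each. -/
noncomputable def gapUniformCwG (T B : ℕ) (x u : ℕ → ℝ) : HiringRule :=
  cwgPolicy gapUniform (fun _ : Fin 1 => ((1 / 4 : ℝ), (3 / 4 : ℝ))) (1 / 2) T B x u

/-! On the quantile scale the candidates are i.i.d. uniform variables `y t`, with abilities
`gapQuantile (y t)` almost surely; low and high candidates are separated by the jump of height 1/2
at quantile 1/2.

Upper bound. Follow the policy up to some time and the hindsight optimum afterwards: the value of
this hybrid drops by `stepLoss` at each step, so the regret is the expected sum of these drops
(`offlineValue_sub_onlineValue`). A wrong hire or rejection costs at most the gap between the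
current ability and the future value of one unit of budget. With `n` periods to go, Hoeffding's
inequality places that value between the abilities at quantiles `p ± e`, where `p` is the
certainty-equivalent quantile and `e = √(2 log n / n)`, for all nontrivial budgets at once up to
probability `2 / n`. If `p` is at least `e` away from 1/2, this window does not cross the jump; if
`p` is closer, the threshold 1/2 ensures that mistakes never cross it. Either way an error costs at
most `e`, and only when the current quantile is within `2 * e` of the threshold, an event of
probability at most `4 * e` (`stepLoss_le_of_typical`). The expected loss per step is thus `O(log T
/ n)`, and the harmonic sum gives `(log T)²`. The second phase has at most 64 steps, each costing at
most 1.

Lower bound. Take `B` above `T / 2` by a small multiple of `√T`. The certainty-equivalent quantile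
starts below 1/2 by order `1 / √T`, and being a martingale with increments `O(1 / T)` it mostly
stays there during a small constant fraction of the horizon (`integral_sq_ceQuantile_sub_le`). Low
candidates just below 1/2, which occur with probability of order `1 / √T` per period, are then
hired. With constant probability more than `B` candidates are high
(`one_ninth_le_real_sum_highSign`), and then every low hire costs at least 1/2. This yields regret
of order `√T`. -/

/-! ### Hindsight optima as functions of the budget -/

/-- The largest total value of at most `b` elements of the finite set `J`. -/
noncomputable def topSum (x : ℕ → ℝ) (J : Finset ℕ) (b : ℕ) : ℝ :=
  (J.powerset.filter (fun s => s.card ≤ b)).sup' ⟨∅, by simp⟩ (fun s => ∑ t ∈ s, x t)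

theorem offlineValue_eq_topSum (x : ℕ → ℝ) (T B : ℕ) :
    offlineValue x T B = topSum x (Finset.range T) B := rfl

theorem sum_le_topSum {x : ℕ → ℝ} {J s : Finset ℕ} {b : ℕ} (hs : s ⊆ J) (hc : s.card ≤ b) :
    ∑ t ∈ s, x t ≤ topSum x J b :=
  Finset.le_sup' (fun s => ∑ t ∈ s, x t) (by simp [hs, hc])

theorem topSum_le {x : ℕ → ℝ} {J : Finset ℕ} {b : ℕ} {a : ℝ}
    (h : ∀ s ⊆ J, s.card ≤ b → ∑ t ∈ s, x t ≤ a) : topSum x J b ≤ a :=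
  Finset.sup'_le _ _ fun s hs => by
    simp only [Finset.mem_filter, Finset.mem_powerset] at hs
    exact h s hs.1 hs.2

theorem exists_topSum_eq (x : ℕ → ℝ) (J : Finset ℕ) (b : ℕ) :
    ∃ s ⊆ J, s.card ≤ b ∧ topSum x J b = ∑ t ∈ s, x t := by
  obtain ⟨s, hs, h⟩ := Finset.exists_mem_eq_sup' (s := J.powerset.filter (fun s => s.card ≤ b))
    ⟨∅, by simp⟩ (fun s => ∑ t ∈ s, x t)
  simp only [Finset.mem_filter, Finset.mem_powerset] at hs
  exact ⟨s, hs.1, hs.2, h⟩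

theorem topSum_mono {x : ℕ → ℝ} {J : Finset ℕ} {b c : ℕ} (h : b ≤ c) :
    topSum x J b ≤ topSum x J c :=
  topSum_le fun _ hs hc => sum_le_topSum hs (hc.trans h)

theorem topSum_empty (x : ℕ → ℝ) (b : ℕ) : topSum x ∅ b = 0 := by
  refine le_antisymm (topSum_le fun s hs _ => ?_) (sum_le_topSum (s := ∅) le_rfl (by simp))
  simp [Finset.subset_empty.1 hs]

theorem topSum_zero (x : ℕ → ℝ) (J : Finset ℕ) : topSum x J 0 = 0 := by
  refine le_antisymm (topSum_le fun s _ hs => ?_) (sum_le_topSum (s := ∅) (by simp) (by simp))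
  simp [Finset.card_eq_zero.1 (Nat.le_zero.1 hs)]

/-- The nontrivial half of the Bellman equation: an optimal selection either avoids `a` or spends
one unit on it. -/
theorem topSum_insert_le {x : ℕ → ℝ} {J : Finset ℕ} {a : ℕ} (b : ℕ) :
    topSum x (insert a J) (b + 1) ≤ max (topSum x J (b + 1)) (x a + topSum x J b) := by
  refine topSum_le fun s hs hc => ?_
  by_cases h : a ∈ s
  · refine le_max_of_le_right ?_
    rw [← Finset.add_sum_erase s x h]
    have : (s.erase a) ⊆ J := fun i hi => by
      have := hs (Finset.mem_of_mem_erase hi)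
      exact Finset.mem_of_mem_insert_of_ne this (Finset.ne_of_mem_erase hi)
    have hc' : (s.erase a).card ≤ b := by rw [Finset.card_erase_of_mem h]; omega
    linarith [sum_le_topSum (x := x) this hc']
  · refine le_max_of_le_left (sum_le_topSum (fun i hi => ?_) hc)
    exact Finset.mem_of_mem_insert_of_ne (hs hi) (fun h' => h (h' ▸ hi))

/-- If at most `b` elements exceed `v ≥ 0`, an extra unit of budget is worth at most `v`. -/
theorem topSum_succ_le {x : ℕ → ℝ} {J : Finset ℕ} {b : ℕ} {v : ℝ} (hv : 0 ≤ v)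
    (h : (J.filter fun i => v < x i).card ≤ b) : topSum x J (b + 1) ≤ topSum x J b + v := by
  refine topSum_le fun s hs hc => ?_
  rcases Nat.lt_or_ge b s.card with hb | hb
  · obtain ⟨i, hi, hi'⟩ : ∃ i ∈ s, x i ≤ v := by
      by_contra! hcon
      have : s ⊆ J.filter fun i => v < x i := fun i hi => by simp [hs hi, hcon i hi]
      have := Finset.card_le_card this
      omega
    rw [← Finset.add_sum_erase s x hi]
    have h2 : (s.erase i).card ≤ b := by rw [Finset.card_erase_of_mem hi]; omega
    linarith [sum_le_topSum (x := x) ((Finset.erase_subset i s).trans hs) h2]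
  · linarith [sum_le_topSum (x := x) hs hb]

/-- If more than `b` elements are at least `v`, an extra unit of budget is worth at least `v`. -/
theorem le_topSum_succ {x : ℕ → ℝ} {J : Finset ℕ} {b : ℕ} {v : ℝ}
    (h : b < (J.filter fun i => v ≤ x i).card) : topSum x J b + v ≤ topSum x J (b + 1) := by
  obtain ⟨s, hs, hc, heq⟩ := exists_topSum_eq x J b
  obtain ⟨i, hi, his⟩ : ∃ i ∈ J.filter fun i => v ≤ x i, i ∉ s :=
    Finset.exists_mem_notMem_of_card_lt_card (hc.trans_lt h)
  simp only [Finset.mem_filter] at hi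
  have : ∑ t ∈ insert i s, x t ≤ topSum x J (b + 1) :=
    sum_le_topSum (Finset.insert_subset hi.1 hs) ((Finset.card_insert_le _ _).trans (by omega))
  rw [Finset.sum_insert his] at this
  linarith

/-! ### Quantile scale and telescoping of the regret -/

/-- The quantile function of `gapUniform`. -/
noncomputable def gapQuantile (y : ℝ) : ℝ := y / 2 + if 1 / 2 < y then 1 / 2 else 0

theorem gapQuantile_strictMono : StrictMono gapQuantile := by
  intro a b h
  unfold gapQuantile
  split_ifs <;> linarith

theorem gapQuantile_mem_Icc {y : ℝ} (h : y ∈ Icc (0 : ℝ) 1) : gapQuantile y ∈ Icc (0 : ℝ) 1 := by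
  obtain ⟨h0, h1⟩ := h
  unfold gapQuantile
  constructor <;> split_ifs <;> linarith

theorem measurable_gapQuantile : Measurable gapQuantile :=
  gapQuantile_strictMono.monotone.measurable

open Classical in
/-- The loss relative to the hindsight optimum that the decision of `rule` for candidate `t` with
remaining budget `b` incurs. -/
noncomputable def stepLoss (x : ℕ → ℝ) (T : ℕ) (rule : HiringRule) (t : ℕ) (b : ℤ) : ℝ :=
  topSum x (Finset.Ico t T) b.toNat -
    if rule t b then x t + topSum x (Finset.Ico (t + 1) T) (b - 1).toNat
    else topSum x (Finset.Ico (t + 1) T) b.toNat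

/-- Telescoping over the hybrids that follow `rule` for `k` periods and then select optimally from
the remaining candidates with the remaining budget. -/
theorem offlineValue_sub_onlineValue (x : ℕ → ℝ) (T B : ℕ) (rule : HiringRule) :
    offlineValue x T B - onlineValue x T B rule =
      ∑ t ∈ Finset.range T, stepLoss x T rule t (remainingBudget B rule t) := by
  have key : ∀ k ≤ T, topSum x (Finset.range T) B - onlineValue x k B rule =
      (∑ t ∈ Finset.range k, stepLoss x T rule t (remainingBudget B rule t)) +
        topSum x (Finset.Ico k T) (remainingBudget B rule k).toNat := by
    intro k
    induction k with
    | zero => intro _; simp [onlineValue, remainingBudget]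
    | succ k ih =>
      intro hk
      have := ih (by omega)
      rw [Finset.sum_range_succ, onlineValue, Finset.sum_range_succ, ← onlineValue]
      simp only [stepLoss, remainingBudget] at this ⊢
      split_ifs with h <;> linarith
  have := key T le_rfl
  simp only [Finset.Ico_self, topSum_empty, add_zero] at this
  exact this

/-- If the optimum also takes candidate `t`, nothing is lost. Otherwise hiring trades one unit of
future budget, worth at most `v`, for `x t`. -/
theorem stepLoss_le_hire {x : ℕ → ℝ} {T : ℕ} {rule : HiringRule} {t b : ℕ} (ht : t < T)
    (hr : rule t ((b : ℤ) + 1)) {v : ℝ} (hv : 0 ≤ v)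
    (hc : ((Finset.Ico (t + 1) T).filter fun i => v < x i).card ≤ b) :
    stepLoss x T rule t ((b : ℤ) + 1) ≤ max (v - x t) 0 := by
  have h1 := topSum_succ_le hv hc
  have h2 := topSum_insert_le (x := x) (J := Finset.Ico (t + 1) T) (a := t) b
  rw [Finset.insert_Ico_add_one_left_eq_Ico ht] at h2
  simp only [stepLoss, hr, if_true]
  have e1 : ((b : ℤ) + 1).toNat = b + 1 := by omega
  have e2 : ((b : ℤ) + 1 - 1).toNat = b := by omega
  rw [e1, e2]
  rcases max_le_iff.1 (le_refl (max (v - x t) 0)) with ⟨h3, h4⟩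
  rcases le_max_iff.1 h2 with h | h <;> linarith

/-- If the optimum takes candidate `t`, rejecting loses `x t` but keeps a unit of budget that is
worth at least `v` later. -/
theorem stepLoss_le_reject {x : ℕ → ℝ} {T : ℕ} {rule : HiringRule} {t b : ℕ} (ht : t < T)
    (hr : ¬ rule t ((b : ℤ) + 1)) {v : ℝ}
    (hc : b < ((Finset.Ico (t + 1) T).filter fun i => v ≤ x i).card) :
    stepLoss x T rule t ((b : ℤ) + 1) ≤ max (x t - v) 0 := by
  have h1 := le_topSum_succ hc
  have h2 := topSum_insert_le (x := x) (J := Finset.Ico (t + 1) T) (a := t) b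
  rw [Finset.insert_Ico_add_one_left_eq_Ico ht] at h2
  simp only [stepLoss, hr, if_false]
  have e1 : ((b : ℤ) + 1).toNat = b + 1 := by omega
  rw [e1]
  rcases max_le_iff.1 (le_refl (max (x t - v) 0)) with ⟨h3, h4⟩
  rcases le_max_iff.1 h2 with h | h <;> linarith

theorem stepLoss_zero_of_reject {x : ℕ → ℝ} {T : ℕ} {rule : HiringRule} {t : ℕ}
    (hr : ¬ rule t 0) : stepLoss x T rule t 0 = 0 := by
  simp [stepLoss, hr, topSum_zero]

theorem stepLoss_le_one {x : ℕ → ℝ} {T : ℕ} {rule : HiringRule} {t : ℕ} (ht : t < T)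
    (hx : ∀ i, x i ∈ Icc (0 : ℝ) 1) (h0 : ¬ rule t 0) {b : ℤ} (hb : 0 ≤ b) :
    stepLoss x T rule t b ≤ 1 := by
  obtain ⟨n, rfl⟩ := Int.eq_ofNat_of_zero_le hb
  cases n with
  | zero => simpa using (stepLoss_zero_of_reject h0).trans_le zero_le_one
  | succ b =>
    push_cast
    by_cases hr : rule t ((b : ℤ) + 1)
    · refine (stepLoss_le_hire ht hr zero_le_one ?_).trans ?_
      · rw [Finset.filter_false_of_mem fun i _ => not_lt.2 (hx i).2]; simp
      · have := (hx t).1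
        exact max_le (by linarith) zero_le_one
    · have h2 := topSum_insert_le (x := x) (J := Finset.Ico (t + 1) T) (a := t) b
      rw [Finset.insert_Ico_add_one_left_eq_Ico ht] at h2
      have h3 : topSum x (Finset.Ico (t + 1) T) b ≤ topSum x (Finset.Ico (t + 1) T) (b + 1) :=
        topSum_mono (by omega)
      simp only [stepLoss, hr, if_false]
      have e1 : ((b : ℤ) + 1).toNat = b + 1 := by omega
      rw [e1]
      have := (hx t).2
      rcases le_max_iff.1 h2 with h | h <;> linarith

theorem remainingBudget_nonneg {B : ℕ} {rule : HiringRule} (h : ∀ t, ¬ rule t 0) (t : ℕ) :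
    0 ≤ remainingBudget B rule t := by
  induction t with
  | zero => simp [remainingBudget]
  | succ t ih =>
    rw [remainingBudget]
    split_ifs with hr
    · have : remainingBudget B rule t ≠ 0 := fun h0 => h t (h0 ▸ hr)
      omega
    · exact ih

/-! ### One step of CwG in a typical future -/

/-- The deviation allowed around the certainty-equivalent quantile with `n` periods to go. -/
noncomputable def quantileRadius (n : ℝ) : ℝ := √(2 * (Real.log n / n))

theorem cwgQuantile_half (T t : ℕ) (b : ℤ) :
    cwgQuantile (fun _ : Fin 1 => (1 / 2 : ℝ)) T t b =
      if |ceQuantile T t b - 1 / 2| < quantileRadius ((T : ℝ) - t) then 1 / 2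
      else ceQuantile T t b := by
  have : (nearGaps (fun _ : Fin 1 => (1 / 2 : ℝ)) T t b).Nonempty ↔
      |ceQuantile T t b - 1 / 2| < quantileRadius ((T : ℝ) - t) := by
    simp only [nearGaps, Finset.filter_nonempty_iff, Metric.mem_ball, Real.dist_eq, quantileRadius,
      Finset.mem_univ, true_and, exists_const]
  unfold cwgQuantile
  simp only [this]
  split_ifs <;> rfl

/-- With `n` periods to go and quantiles `y` in the future, the number of future quantiles beyond
`1 - b / n ± quantileRadius n` compares with `b` as expected. -/
def FutureTypical (y : ℕ → ℝ) (T t b : ℕ) : Prop :=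
  ((Finset.Ico (t + 1) T).filter fun i =>
      ceQuantile T t b + quantileRadius ((T : ℝ) - t) < y i).card < b ∧
    b ≤ ((Finset.Ico (t + 1) T).filter fun i =>
      ceQuantile T t b - quantileRadius ((T : ℝ) - t) < y i).card

/-- In a typical future the loss of the conservative threshold is small, and zero unless the current
quantile is near the threshold. -/
theorem stepLoss_le_of_typical {y : ℕ → ℝ} {T t b : ℕ} {rule : HiringRule} {p : ℝ} (ht : t < T)
    (hb0 : 0 < b) (hbT : b ≤ T - t) (hy : y t ≠ 1 / 2)
    (hrad : 0 < quantileRadius ((T : ℝ) - t))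
    (hp : p = cwgQuantile (fun _ : Fin 1 => (1 / 2 : ℝ)) T t b)
    (hrule : rule t b ↔ p ≤ y t) (hF : FutureTypical y T t b) :
    stepLoss (fun i => gapQuantile (y i)) T rule t b ≤
      if |y t - p| ≤ 2 * quantileRadius ((T : ℝ) - t) then quantileRadius ((T : ℝ) - t) else 0 := by
  have hp0 : 0 ≤ ceQuantile T t b := by
    have h1 : (0 : ℝ) < (T : ℝ) - t := by
      have : (t : ℝ) < T := by exact_mod_cast ht
      linarith
    have h2 : (b : ℝ) ≤ (T : ℝ) - t := by
      rw [← Nat.cast_sub ht.le]; exact_mod_cast hbT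
    unfold ceQuantile
    rw [sub_nonneg, div_le_one h1]
    exact_mod_cast h2
  rw [cwgQuantile_half] at hp
  obtain ⟨hF1, hF2⟩ := hF
  set e := quantileRadius ((T : ℝ) - t)
  set p0 := ceQuantile T t b
  obtain ⟨c, rfl⟩ : ∃ c, b = c + 1 := ⟨b - 1, by omega⟩
  push_cast at hrule ⊢
  have hq0 : 0 ≤ gapQuantile (p0 + e) := by
    unfold gapQuantile; split_ifs <;> linarith
  by_cases hr : rule t ((c : ℤ) + 1)
  · have hpy := hrule.1 hr
    -- Near the gap, a hired candidate is high because `y t ≠ 1 / 2`, so the jump cancels from the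
    -- loss and `(p0 + e - y t) / 2 ≤ e` remains. Away from it, `p0` and `p0 + e` are on the same
    -- side of the jump.
    refine (stepLoss_le_hire ht hr (v := gapQuantile (p0 + e)) hq0 ?_).trans ?_
    · simp only [gapQuantile_strictMono.lt_iff_lt]; omega
    · rw [abs_of_nonneg (by linarith)]
      unfold gapQuantile
      rcases lt_or_gt_of_ne hy with hy' | hy'
      all_goals
        by_cases hn : |p0 - 1 / 2| < e
        · rw [if_pos hn] at hp
          rw [abs_lt] at hn
          refine max_le ?_ ?_ <;> split_ifs <;> linarith
        · rw [if_neg hn] at hp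
          rw [not_lt, le_abs] at hn
          rcases hn with hn | hn <;> refine max_le ?_ ?_ <;> split_ifs <;> linarith
  · have hpy := not_le.1 (fun h => hr (hrule.2 h))
    -- This `v` is the right limit of `gapQuantile` at `p0 - e`. It is still a lower bound, since
    -- the counted quantiles exceed `p0 - e` strictly, and it is needed when `p0 - e = 1 / 2`, where
    -- `gapQuantile` itself takes the low value 1/4.
    refine (stepLoss_le_reject ht hr (v := (p0 - e) / 2 + if 1 / 2 ≤ p0 - e then 1 / 2 else 0)
      ?_).trans ?_
    · refine (Nat.lt_of_lt_of_le (Nat.lt_succ_self c) hF2).trans_le (Finset.card_le_card ?_)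
      intro i hi
      simp only [Finset.mem_filter] at hi ⊢
      refine ⟨hi.1, ?_⟩
      unfold gapQuantile
      split_ifs <;> linarith [hi.2]
    · rw [abs_of_nonpos (by linarith)]
      unfold gapQuantile
      rcases lt_or_gt_of_ne hy with hy' | hy'
      all_goals
        by_cases hn : |p0 - 1 / 2| < e
        · rw [if_pos hn] at hp
          rw [abs_lt] at hn
          refine max_le ?_ ?_ <;> split_ifs <;> linarith
        · rw [if_neg hn] at hp
          rw [not_lt, le_abs] at hn
          rcases hn with hn | hn <;> refine max_le ?_ ?_ <;> split_ifs <;> linarith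

/-- With budget for all remaining candidates, hiring costs nothing. -/
theorem stepLoss_nonpos_of_le {x : ℕ → ℝ} {T : ℕ} {rule : HiringRule} {t b : ℕ} (ht : t < T)
    (hx : 0 ≤ x t) (hb : T - t ≤ b) (hr : rule t b) : stepLoss x T rule t b ≤ 0 := by
  obtain ⟨c, rfl⟩ : ∃ c, b = c + 1 := ⟨b - 1, by omega⟩
  push_cast at hr ⊢
  refine (stepLoss_le_hire ht hr le_rfl ?_).trans (by simpa using hx)
  refine (Finset.card_filter_le _ _).trans ?_
  simp; omega

/-- Ensures that a certainty-equivalent quantile `≤ 0` is never deemed near the gap, so CwG hires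
everyone once the budget covers all remaining candidates. -/
theorem quantileRadius_lt_half {n : ℝ} (hn : 32 ≤ n) : quantileRadius n < 1 / 2 := by
  unfold quantileRadius
  rw [Real.sqrt_lt' (by norm_num)]
  have h1 : Real.log n = Real.log (n / 32) + 5 * Real.log 2 := by
    rw [Real.log_div (by linarith) (by norm_num), show (32 : ℝ) = 2 ^ 5 by norm_num, Real.log_pow]
    push_cast; ring
  have h2 := Real.log_le_sub_one_of_pos (show 0 < n / 32 by linarith)
  have h3 := Real.log_two_lt_d9
  have : Real.log n / n < 1 / 8 := by
    rw [div_lt_iff₀ (by linarith)]; linarith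
  linarith

theorem quantileRadius_pos {n : ℝ} (hn : 1 < n) : 0 < quantileRadius n := by
  have := Real.log_pos hn
  unfold quantileRadius
  positivity

theorem quantileRadius_sq {n : ℝ} (hn : 1 ≤ n) : quantileRadius n ^ 2 = 2 * (Real.log n / n) := by
  have := Real.log_nonneg hn
  unfold quantileRadius
  rw [Real.sq_sqrt (by positivity)]

/-! ### Independence and concentration for uniform quantiles -/

/-- Independent random variables with the uniform distribution on `[0, 1]`. -/
structure IsUniformSequence {Ω : Type*} [MeasurableSpace Ω] (P : Measure Ω) (Y : ℕ → Ω → ℝ) :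
    Prop where
  measurable : ∀ t, Measurable (Y t)
  law : ∀ t, P.map (Y t) = (volume : Measure ℝ).restrict (Icc 0 1)
  indep : iIndepFun Y P

namespace IsUniformSequence

variable {Ω : Type*} [MeasurableSpace Ω] {P : Measure Ω} {Y : ℕ → Ω → ℝ}

theorem measurable_path (hY : IsUniformSequence P Y) : Measurable fun ω i => Y i ω :=
  measurable_pi_iff.2 hY.measurable

theorem real_mem (hY : IsUniformSequence P Y) (t : ℕ) {s : Set ℝ} (hs : MeasurableSet s) :
    P.real {ω | Y t ω ∈ s} = volume.real (s ∩ Icc 0 1) := by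
  have : P.real {ω | Y t ω ∈ s} = (P.map (Y t)).real s :=
    (map_measureReal_apply (hY.measurable t) hs).symm
  rw [this, hY.law, measureReal_restrict_apply hs]

theorem ae_mem_Ico (hY : IsUniformSequence P Y) : ∀ᵐ ω ∂P, ∀ t, Y t ω ∈ Ico (0 : ℝ) 1 := by
  rw [ae_all_iff]
  intro t
  have h : ∀ᵐ y ∂(P.map (Y t)), y ∈ Ico (0 : ℝ) 1 := by
    rw [hY.law, restrict_Ico_eq_restrict_Icc.symm]
    exact ae_restrict_mem measurableSet_Ico
  exact ae_of_ae_map (hY.measurable t).aemeasurable h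

theorem ae_ne (hY : IsUniformSequence P Y) (c : ℝ) : ∀ᵐ ω ∂P, ∀ t, Y t ω ≠ c := by
  rw [ae_all_iff]
  intro t
  have h : ∀ᵐ y ∂(P.map (Y t)), y ≠ c := by
    rw [hY.law]
    exact ae_restrict_of_ae (Measure.ae_ne volume c)
  exact ae_of_ae_map (hY.measurable t).aemeasurable h

/-- Setting the coordinates outside `s` to zero leaves `f` unchanged and shows that it is measurable
for the σ-algebra generated by the coordinates in `s`. -/
theorem indepFun_of_dependsOn (hY : IsUniformSequence P Y)
    {α : Type*} [MeasurableSpace α] {f : (ℕ → ℝ) → α} (hf : Measurable f) {s : Set ℕ}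
    (hd : DependsOn f s) {t : ℕ} (ht : t ∉ s) :
    IndepFun (fun ω => f fun i => Y i ω) (Y t) P := by
  have h := indep_iSup_of_disjoint (m := fun i => MeasurableSpace.comap (Y i) inferInstance)
    (fun i => (hY.measurable i).comap_le) hY.indep
    (S := s) (T := {t}) (Set.disjoint_singleton_right.2 ht)
  rw [IndepFun_iff_Indep]
  classical
  refine indep_of_indep_of_le_left (indep_of_indep_of_le_right h ?_) ?_
  · exact le_iSup₂_of_le t rfl le_rfl
  · rw [← measurable_iff_comap_le]
    have e : (fun ω => f fun i => Y i ω) = fun ω => f fun i => if i ∈ s then Y i ω else 0 := by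
      funext ω
      exact hd fun i hi => by simp [hi]
    rw [e]
    refine hf.comp (@measurable_pi_lambda _ _ _
      (⨆ i ∈ s, MeasurableSpace.comap (Y i) inferInstance) _ _ fun i => ?_)
    by_cases hi : i ∈ s
    · simp only [hi, if_true]
      exact measurable_iff_comap_le.2
        (le_iSup₂_of_le (f := fun i _ => MeasurableSpace.comap (Y i) inferInstance) i hi le_rfl)
    · simp only [hi, if_false]
      exact measurable_const

theorem real_lt (hY : IsUniformSequence P Y) (t : ℕ) {q : ℝ} (h0 : 0 ≤ q) (h1 : q ≤ 1) :
    P.real {ω | q < Y t ω} = 1 - q := by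
  have := hY.real_mem t (measurableSet_Ioi (a := q))
  simp only [mem_Ioi] at this
  rw [this]
  have : Ioi q ∩ Icc 0 1 = Ioc q 1 := by
    ext y; simp only [mem_inter_iff, mem_Ioi, mem_Icc, mem_Ioc]; constructor
    · rintro ⟨a, b, c⟩; exact ⟨a, c⟩
    · rintro ⟨a, b⟩; exact ⟨a, by linarith, b⟩
  rw [this, Measure.real, Real.volume_Ioc, ENNReal.toReal_ofReal (by linarith)]

variable [IsProbabilityMeasure P]

/-- Freezing lemma: a statistic of the other coordinates may be held fixed while `Y t` is integrated
out. -/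
theorem integral_eq_of_dependsOn (hY : IsUniformSequence P Y)
    {α : Type*} [MeasurableSpace α] {f : (ℕ → ℝ) → α} (hf : Measurable f) {s : Set ℕ}
    (hd : DependsOn f s) {t : ℕ} (ht : t ∉ s) {φ : α × ℝ → ℝ} (hφ : Measurable φ)
    (hint : Integrable (fun ω => φ (f fun i => Y i ω, Y t ω)) P) :
    ∫ ω, φ (f fun i => Y i ω, Y t ω) ∂P =
      ∫ ω, (∫ y in Icc (0 : ℝ) 1, φ (f fun i => Y i ω, y)) ∂P := by
  have hF : Measurable fun ω => f fun i => Y i ω := hf.comp hY.measurable_path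
  have hm : Measurable fun ω => (f fun i => Y i ω, Y t ω) := hF.prodMk (hY.measurable t)
  have hI := (hY.indepFun_of_dependsOn hf hd ht).map_prod_eq_prod_map_map hF.aemeasurable
    (hY.measurable t).aemeasurable
  rw [hY.law] at hI
  have h1 := integral_map (μ := P) hm.aemeasurable (f := φ) hφ.aestronglyMeasurable
  have : IsProbabilityMeasure (P.map fun ω => f fun i => Y i ω) :=
    Measure.isProbabilityMeasure_map hF.aemeasurable
  have hi := (integrable_map_measure (μ := P) hφ.aestronglyMeasurable hm.aemeasurable).2 hint
  rw [hI] at h1 hi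
  rw [← h1, integral_prod _ hi]
  exact integral_map hF.aemeasurable hi.aestronglyMeasurable.integral_prod_right'

/-- **Hoeffding's inequality** for the number of uniform variables above a level. -/
theorem real_card_ge_le (hY : IsUniformSequence P Y) {J : Finset ℕ} (hJ : J.Nonempty) (q : ℝ)
    {e : ℝ} (he : 0 ≤ e) :
    P.real {ω | J.card * P.real {ω | q < Y 0 ω} + J.card * e ≤ (J.filter fun i => q < Y i ω).card}
        ≤ Real.exp (-2 * J.card * e ^ 2) ∧
      P.real {ω | ((J.filter fun i => q < Y i ω).card : ℝ) ≤
        J.card * P.real {ω | q < Y 0 ω} - J.card * e} ≤ Real.exp (-2 * J.card * e ^ 2) := by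
  have hlaw : ∀ i, P.real {ω | q < Y i ω} = P.real {ω | q < Y 0 ω} := fun i =>
    (hY.real_mem i measurableSet_Ioi).trans (hY.real_mem 0 measurableSet_Ioi).symm
  set π := P.real {ω | q < Y 0 ω} with hπ
  let g : ℝ → ℝ := (Ioi q).indicator 1
  have hg : Measurable g := measurable_one.indicator measurableSet_Ioi
  have hmean : ∀ i, ∫ ω, g (Y i ω) ∂P = π := fun i => by
    rw [← hlaw i]
    have : (fun ω => g (Y i ω)) = (Y i ⁻¹' Ioi q).indicator 1 := rfl
    rw [this, integral_indicator_one ((hY.measurable i) measurableSet_Ioi)]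
    rfl
  have hsub : ∀ i, HasSubgaussianMGF (fun ω => g (Y i ω) - π) ((‖(1 : ℝ) - 0‖₊ / 2) ^ 2) P := by
    intro i
    have := hasSubgaussianMGF_of_mem_Icc (μ := P) (X := fun ω => g (Y i ω)) (a := 0) (b := 1)
      (hg.comp (hY.measurable i)).aemeasurable (Filter.Eventually.of_forall fun ω => by
        simp only [g, Set.indicator_apply]; split_ifs <;> simp)
    rwa [hmean i] at this
  have hind : iIndepFun (fun i ω => g (Y i ω) - π) P :=
    hY.indep.comp (fun _ y => g y - π) fun _ => hg.sub_const _
  have hind' : iIndepFun (fun i ω => -(g (Y i ω) - π)) P :=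
    hY.indep.comp (fun _ y => -(g y - π)) fun _ => (hg.sub_const _).neg
  have hs : ∀ ω, ∑ i ∈ J, (g (Y i ω) - π) = ((J.filter fun i => q < Y i ω).card : ℝ) - J.card * π := by
    intro ω
    rw [Finset.sum_sub_distrib, Finset.card_filter]
    simp [g, Set.indicator_apply]
  have hc : (0 : ℝ) < J.card := by exact_mod_cast hJ.card_pos
  have hval : -(J.card * e) ^ 2 / (2 * ((∑ _i ∈ J, (‖(1 : ℝ) - 0‖₊ / 2) ^ 2 : NNReal) : ℝ)) =
      -2 * J.card * e ^ 2 := by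
    simp
    field_simp
  constructor
  · have h := HasSubgaussianMGF.measure_sum_ge_le_of_iIndepFun hind (s := J) (fun i _ => hsub i)
      (ε := J.card * e) (by positivity)
    rw [hval] at h
    refine le_trans (le_of_eq ?_) h
    congr 1
    ext ω
    simp only [mem_ofPred_eq, hs]
    constructor <;> intro h <;> linarith
  · have h := HasSubgaussianMGF.measure_sum_ge_le_of_iIndepFun hind' (s := J)
      (fun i _ => (hsub i).neg) (ε := J.card * e) (by positivity)
    rw [hval] at h
    refine le_trans (le_of_eq ?_) h
    congr 1
    ext ω
    simp only [mem_ofPred_eq, Finset.sum_neg_distrib, hs]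
    constructor <;> intro h <;> linarith

/-- Among the `n - 1` future candidates the expected numbers beyond `p0 ± e` differ from `(n - 1) *
b / n` by `(n - 1) * e`, and `b - 1 ≤ (n - 1) * b / n ≤ b`. Hence each failure is a deviation of
relative size `e`. -/
theorem real_not_futureTypical_le (hY : IsUniformSequence P Y) {T t b : ℕ} (ht : t + 1 < T)
    (hb : 0 < b) (hbT : b < T - t) :
    P.real {ω | ¬ FutureTypical (fun i => Y i ω) T t b} ≤ 2 / ((T : ℝ) - t) ^ 2 := by
  set n : ℝ := (T : ℝ) - t with hn
  have hnat : ((T - t : ℕ) : ℝ) = n := by rw [Nat.cast_sub (by omega)]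
  have hn2 : 2 ≤ n := by rw [← hnat]; exact_mod_cast (by omega : 2 ≤ T - t)
  have hbn : (b : ℝ) + 1 ≤ n := by rw [← hnat]; exact_mod_cast hbT
  have hb1 : (1 : ℝ) ≤ b := by exact_mod_cast hb
  set J := Finset.Ico (t + 1) T with hJ
  have hcard : (J.card : ℝ) = n - 1 := by
    rw [hJ, Nat.card_Ico, ← hnat, Nat.cast_sub ht.le, Nat.cast_sub (by omega)]
    push_cast; ring
  have hJn : J.Nonempty := by rw [hJ, Finset.nonempty_Ico]; exact ht
  set e := quantileRadius n with he
  have he0 : 0 < e := quantileRadius_pos (by linarith)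
  -- The factor 2 in the squared radius makes the exponent `-4 * log n * (n - 1) / n`, which is at
  -- most `-2 * log n` for `n ≥ 2`.
  have hexp : Real.exp (-2 * J.card * e ^ 2) ≤ 1 / n ^ 2 := by
    rw [hcard, he, quantileRadius_sq (by linarith)]
    have : (1 : ℝ) / n ^ 2 = Real.exp (-2 * Real.log n) := by
      rw [show -2 * Real.log n = -(Real.log n + Real.log n) by ring, Real.exp_neg, Real.exp_add,
        Real.exp_log (by linarith)]
      field_simp
    rw [this, Real.exp_le_exp]
    have hl := Real.log_nonneg (show (1 : ℝ) ≤ n by linarith)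
    have : 1 / 2 ≤ (n - 1) / n := by rw [div_le_div_iff₀ (by norm_num) (by linarith)]; linarith
    have h2 : -2 * (n - 1) * (2 * (Real.log n / n)) = -4 * (Real.log n * ((n - 1) / n)) := by
      field_simp; ring
    rw [h2]
    nlinarith
  have hp0 : ceQuantile T t b = 1 - b / n := by simp [ceQuantile, hn]
  have hbn0 : 0 < (b : ℝ) / n := by positivity
  have hbn1 : (b : ℝ) / n < 1 := by rw [div_lt_one (by linarith)]; linarith
  have hbn2 : n * ((b : ℝ) / n) = b := by field_simp
  set p0 := ceQuantile T t b with hp0'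
  have h1 : P.real {ω | b ≤ (J.filter fun i => p0 + e < Y i ω).card} ≤ 1 / n ^ 2 := by
    rcases le_or_gt (p0 + e) 1 with hq | hq
    · refine le_trans (measureReal_mono ?_) ((hY.real_card_ge_le hJn (p0 + e) he0.le).1.trans hexp)
      intro ω hω
      simp only [mem_ofPred_eq] at hω ⊢
      rw [hY.real_lt 0 (by linarith) hq, hcard]
      have : (b : ℝ) ≤ ((J.filter fun i => p0 + e < Y i ω).card : ℝ) := by exact_mod_cast hω
      nlinarith
    -- No quantile exceeds a level above 1, so the count vanishes while `b > 0`.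
    · have : P.real {ω | b ≤ (J.filter fun i => p0 + e < Y i ω).card} = 0 := by
        rw [measureReal_eq_zero_iff]
        refine measure_mono_null ?_ (ae_iff.1 hY.ae_mem_Ico)
        intro ω hω hmem
        simp only [mem_ofPred_eq] at hω
        rw [Finset.filter_false_of_mem] at hω
        · simp at hω; omega
        · intro i _
          have := (hmem i).2
          linarith
      rw [this]; positivity
  have h2 : P.real {ω | (J.filter fun i => p0 - e < Y i ω).card < b} ≤ 1 / n ^ 2 := by
    rcases le_or_gt 0 (p0 - e) with hq | hq
    · refine le_trans (measureReal_mono ?_) ((hY.real_card_ge_le hJn (p0 - e) he0.le).2.trans hexp)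
      intro ω hω
      simp only [mem_ofPred_eq] at hω ⊢
      rw [hY.real_lt 0 hq (by linarith), hcard]
      have : ((J.filter fun i => p0 - e < Y i ω).card : ℝ) + 1 ≤ b := by exact_mod_cast hω
      nlinarith
    -- Every quantile exceeds a negative level, so the count is `n - 1`, which is at least `b`.
    · have : P.real {ω | (J.filter fun i => p0 - e < Y i ω).card < b} = 0 := by
        rw [measureReal_eq_zero_iff]
        refine measure_mono_null ?_ (ae_iff.1 hY.ae_mem_Ico)
        intro ω hω hmem
        simp only [mem_ofPred_eq] at hω
        rw [Finset.filter_true_of_mem] at hω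
        · rw [hJ, Nat.card_Ico] at hω; omega
        · intro i _
          have := (hmem i).1
          linarith
      rw [this]; positivity
  calc P.real {ω | ¬ FutureTypical (fun i => Y i ω) T t b}
      ≤ P.real ({ω | b ≤ (J.filter fun i => p0 + e < Y i ω).card} ∪
          {ω | (J.filter fun i => p0 - e < Y i ω).card < b}) := by
        refine measureReal_mono ?_
        intro ω hω
        simp only [FutureTypical, mem_ofPred_eq, not_and_or, not_lt, not_le] at hω
        exact hω
    _ ≤ _ := measureReal_union_le _ _
    _ ≤ 1 / n ^ 2 + 1 / n ^ 2 := add_le_add h1 h2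
    _ = 2 / n ^ 2 := by ring

/-- The union over fewer than `n` budgets allows the bound to be applied at the random remaining
budget without conditioning on it. -/
theorem real_exists_not_futureTypical_le (hY : IsUniformSequence P Y) {T t : ℕ} (ht : t + 1 < T) :
    P.real {ω | ∃ b, 0 < b ∧ b < T - t ∧ ¬ FutureTypical (fun i => Y i ω) T t b} ≤
      2 / ((T : ℝ) - t) := by
  have hnat : ((T - t : ℕ) : ℝ) = (T : ℝ) - t := by rw [Nat.cast_sub (by omega)]
  have hn2 : 2 ≤ (T : ℝ) - t := by rw [← hnat]; exact_mod_cast (by omega : 2 ≤ T - t)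
  calc P.real {ω | ∃ b, 0 < b ∧ b < T - t ∧ ¬ FutureTypical (fun i => Y i ω) T t b}
      ≤ P.real (⋃ b ∈ Finset.Ico 1 (T - t), {ω | ¬ FutureTypical (fun i => Y i ω) T t b}) := by
        refine measureReal_mono ?_ (measure_ne_top _ _)
        rintro ω ⟨b, hb, hb', h⟩
        simp only [mem_iUnion, Finset.mem_Ico]
        exact ⟨b, ⟨hb, hb'⟩, h⟩
    _ ≤ ∑ b ∈ Finset.Ico 1 (T - t), P.real {ω | ¬ FutureTypical (fun i => Y i ω) T t b} :=
        measureReal_biUnion_finset_le _ _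
    _ ≤ ∑ b ∈ Finset.Ico 1 (T - t), 2 / ((T : ℝ) - t) ^ 2 := by
        refine Finset.sum_le_sum fun b hb => ?_
        rw [Finset.mem_Ico] at hb
        exact hY.real_not_futureTypical_le ht (by omega) hb.2
    _ ≤ ((T : ℝ) - t) * (2 / ((T : ℝ) - t) ^ 2) := by
        rw [Finset.sum_const, nsmul_eq_mul]
        refine mul_le_mul_of_nonneg_right ?_ (by positivity)
        rw [← hnat, Nat.card_Ico]
        exact_mod_cast Nat.sub_le _ _
    _ = 2 / ((T : ℝ) - t) := by field_simp

end IsUniformSequence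

/-! ### Measurability, adaptedness and integrability -/

theorem measurable_remainingBudget {R : (ℕ → ℝ) → HiringRule}
    (hR : ∀ t b, MeasurableSet {y | R y t b}) (B t : ℕ) :
    Measurable fun y => remainingBudget B (R y) t := by
  classical
  induction t with
  | zero => exact measurable_const
  | succ t ih =>
    simp only [remainingBudget]
    refine Measurable.ite ?_ (ih.sub_const 1) ih
    have : {y | R y t (remainingBudget B (R y) t)} =
        ⋃ b : ℤ, {y | remainingBudget B (R y) t = b} ∩ {y | R y t b} := by
      ext y; simp
    rw [this]
    exact MeasurableSet.iUnion fun b => (ih (measurableSet_singleton b)).inter (hR t b)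

theorem measurableSet_rule_remainingBudget {R : (ℕ → ℝ) → HiringRule}
    (hR : ∀ t b, MeasurableSet {y | R y t b}) (B t : ℕ) :
    MeasurableSet {y | R y t (remainingBudget B (R y) t)} := by
  have : {y | R y t (remainingBudget B (R y) t)} =
      ⋃ b : ℤ, {y | remainingBudget B (R y) t = b} ∩ {y | R y t b} := by
    ext y; simp
  rw [this]
  exact MeasurableSet.iUnion fun b =>
    (measurable_remainingBudget hR B t (measurableSet_singleton b)).inter (hR t b)

theorem measurable_onlineValue {R : (ℕ → ℝ) → HiringRule}
    (hR : ∀ t b, MeasurableSet {y | R y t b}) (T B : ℕ) {g : ℝ → ℝ} (hg : Measurable g) :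
    Measurable fun y : ℕ → ℝ => onlineValue (fun i => g (y i)) T B (R y) := by
  classical
  unfold onlineValue
  exact Finset.measurable_sum _ fun t _ =>
    Measurable.ite (measurableSet_rule_remainingBudget hR B t) (hg.comp (measurable_pi_apply t))
      measurable_const

theorem measurable_topSum (J : Finset ℕ) (b : ℕ) {g : ℝ → ℝ} (hg : Measurable g) :
    Measurable fun y : ℕ → ℝ => topSum (fun i => g (y i)) J b := by
  have hne : (J.powerset.filter (fun s => s.card ≤ b)).Nonempty := ⟨∅, by simp⟩
  convert! Finset.measurable_sup' hne (f := fun s (y : ℕ → ℝ) => ∑ t ∈ s, g (y t))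
    (fun s _ => Finset.measurable_sum _ fun t _ => hg.comp (measurable_pi_apply t)) using 1
  ext y
  rw [Finset.sup'_apply, topSum]

theorem dependsOn_remainingBudget {R : (ℕ → ℝ) → HiringRule} (B t : ℕ)
    (hR : ∀ s < t, ∀ b, DependsOn (fun y => R y s b) (Iio t)) :
    DependsOn (fun y => remainingBudget B (R y) t) (Iio t) := by
  intro y y' h
  have : ∀ s ≤ t, remainingBudget B (R y) s = remainingBudget B (R y') s := by
    intro s
    induction s with
    | zero => intro _; rfl
    | succ s ih =>
      intro hs
      have hiff : R y s (remainingBudget B (R y) s) ↔ R y' s (remainingBudget B (R y') s) := by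
        rw [ih (by omega)]
        exact iff_of_eq (hR s (by omega) _ h)
      simp only [remainingBudget, ih (by omega)]
      split_ifs with h1 h2 h2
      · rfl
      · exact absurd (hiff.1 h1) h2
      · exact absurd (hiff.2 h2) h1
      · rfl
  exact this t le_rfl

theorem topSum_mem_Icc {x : ℕ → ℝ} (hx : ∀ i, x i ∈ Icc (0 : ℝ) 1) (J : Finset ℕ) (b : ℕ) :
    topSum x J b ∈ Icc (0 : ℝ) J.card := by
  refine ⟨?_, topSum_le fun s hs _ => ?_⟩
  · simpa using sum_le_topSum (x := x) (J := J) (b := b) (s := ∅) (by simp) (by simp)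
  · calc ∑ t ∈ s, x t ≤ ∑ t ∈ J, x t :=
        Finset.sum_le_sum_of_subset_of_nonneg hs fun i _ _ => (hx i).1
      _ ≤ ∑ t ∈ J, 1 := Finset.sum_le_sum fun i _ => (hx i).2
      _ = J.card := by simp

theorem onlineValue_mem_Icc {x : ℕ → ℝ} (hx : ∀ i, x i ∈ Icc (0 : ℝ) 1) (T B : ℕ)
    (rule : HiringRule) : onlineValue x T B rule ∈ Icc (0 : ℝ) T := by
  classical
  unfold onlineValue
  refine ⟨Finset.sum_nonneg fun i _ => ?_, ?_⟩
  · split_ifs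
    exacts [(hx i).1, le_rfl]
  · calc _ ≤ ∑ t ∈ Finset.range T, (1 : ℝ) := Finset.sum_le_sum fun i _ => by
          split_ifs
          exacts [(hx i).2, zero_le_one]
      _ = T := by simp

namespace IsUniformSequence

variable {Ω : Type*} [MeasurableSpace Ω] {P : Measure Ω} {Y : ℕ → Ω → ℝ}

theorem ae_gapQuantile_mem (hY : IsUniformSequence P Y) :
    ∀ᵐ ω ∂P, ∀ i, gapQuantile (Y i ω) ∈ Icc (0 : ℝ) 1 := by
  filter_upwards [hY.ae_mem_Ico] with ω hω i
  exact gapQuantile_mem_Icc (Ico_subset_Icc_self (hω i))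

variable [IsProbabilityMeasure P]

theorem integrable_topSum (hY : IsUniformSequence P Y) (J : Finset ℕ) (b : ℕ) :
    Integrable (fun ω => topSum (fun i => gapQuantile (Y i ω)) J b) P := by
  refine Integrable.of_bound ((measurable_topSum J b measurable_gapQuantile).comp
    hY.measurable_path).aestronglyMeasurable J.card ?_
  filter_upwards [hY.ae_gapQuantile_mem] with ω hω
  have := topSum_mem_Icc hω J b
  rw [Real.norm_of_nonneg this.1]
  exact this.2

theorem integrable_onlineValue (hY : IsUniformSequence P Y) {R : (ℕ → ℝ) → HiringRule}
    (hR : ∀ t b, MeasurableSet {y | R y t b}) (T B : ℕ) :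
    Integrable (fun ω => onlineValue (fun i => gapQuantile (Y i ω)) T B (R fun i => Y i ω)) P := by
  refine Integrable.of_bound ((measurable_onlineValue hR T B measurable_gapQuantile).comp
    hY.measurable_path).aestronglyMeasurable T ?_
  filter_upwards [hY.ae_gapQuantile_mem] with ω hω
  have := onlineValue_mem_Icc hω T B (R fun i => Y i ω)
  rw [Real.norm_of_nonneg this.1]
  exact this.2

end IsUniformSequence

/-! ### Logarithmic regret of CwG -/

/-- The CwG policy for `gapUniform` in terms of the quantiles `y` of the candidates. -/
noncomputable def cwgQuantileRule (T B : ℕ) (y : ℕ → ℝ) : HiringRule :=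
  thresholdRule y fun t b =>
    if t < firstPhase (1 / 2) T then cwgQuantile (fun _ : Fin 1 => (1 / 2 : ℝ)) T t b
    else ceQuantile T (firstPhase (1 / 2) T)
      (firstPhaseBudget (fun _ : Fin 1 => (1 / 2 : ℝ)) (1 / 2) T B y)

theorem measurableSet_cwgQuantileRule (T B t : ℕ) (b : ℤ) :
    MeasurableSet {y | cwgQuantileRule T B y t b} := by
  have hbud : Measurable fun y =>
      firstPhaseBudget (fun _ : Fin 1 => (1 / 2 : ℝ)) (1 / 2) T B y := by
    refine measurable_remainingBudget (R := fun y => thresholdRule y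
      (cwgQuantile (fun _ : Fin 1 => (1 / 2 : ℝ)) T)) (fun s c => ?_) B _
    simp only [thresholdRule]
    exact (measurableSet_le measurable_const (measurable_pi_apply s)).inter
      (MeasurableSet.const _)
  simp only [cwgQuantileRule, thresholdRule]
  refine MeasurableSet.inter (measurableSet_le ?_ (measurable_pi_apply t)) (MeasurableSet.const _)
  split_ifs
  · exact measurable_const
  · exact (Measurable.of_discrete (f := fun c : ℤ => ceQuantile T (firstPhase (1 / 2) T) c)).comp
      hbud

theorem not_cwgQuantileRule_zero (T B t : ℕ) (y : ℕ → ℝ) : ¬ cwgQuantileRule T B y t 0 := by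
  simp [cwgQuantileRule, thresholdRule]

theorem dependsOn_cwgQuantileRule_budget {T t : ℕ} (B : ℕ) (ht : t < firstPhase (1 / 2) T) :
    DependsOn (fun y => remainingBudget B (cwgQuantileRule T B y) t) (Iio t) := by
  refine dependsOn_remainingBudget B t fun s hs b y y' h => ?_
  simp only [cwgQuantileRule, thresholdRule, if_pos (hs.trans ht), h s hs]

/-- The floor is that of `64 * log 2`. The lower bound keeps the radius below 1/2 in the first
phase; the upper bound controls the length of the second. -/
theorem firstPhase_half_bounds :
    32 ≤ ⌊16 * Real.log (1 / (1 / 2)) / (1 / 2) ^ 2⌋₊ ∧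
      ⌊16 * Real.log (1 / (1 / 2)) / (1 / 2) ^ 2⌋₊ ≤ 64 := by
  have h1 := Real.log_two_gt_d9
  have h2 := Real.log_two_lt_d9
  have h : (1 : ℝ) / (1 / 2) = 2 := by norm_num
  have h' : 16 * Real.log 2 / (1 / 2) ^ 2 = 64 * Real.log 2 := by ring
  rw [h, h']
  constructor
  · apply Nat.le_floor; push_cast; linarith
  · apply Nat.floor_le_of_le; push_cast; linarith

theorem setIntegral_near_le (p e : ℝ) (he : 0 ≤ e) :
    ∫ y in Icc (0 : ℝ) 1, (if |y - p| ≤ 2 * e then e else 0) ≤ 4 * e ^ 2 := by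
  have h : (fun y : ℝ => if |y - p| ≤ 2 * e then e else 0) =
      (Icc (p - 2 * e) (p + 2 * e)).indicator fun _ => e := by
    funext y
    simp only [Set.indicator_apply, mem_Icc, abs_le]
    congr 1
    exact propext ⟨fun h => ⟨by linarith [h.1], by linarith [h.2]⟩,
      fun h => ⟨by linarith [h.1], by linarith [h.2]⟩⟩
  rw [h, integral_indicator measurableSet_Icc, setIntegral_const, smul_eq_mul,
    measureReal_restrict_apply measurableSet_Icc]
  have : volume.real (Icc (p - 2 * e) (p + 2 * e) ∩ Icc 0 1) ≤ 4 * e := by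
    refine (measureReal_mono inter_subset_left (by simp)).trans ?_
    rw [Measure.real, Real.volume_Icc, ENNReal.toReal_ofReal (by linarith)]
    linarith
  nlinarith

namespace IsUniformSequence

variable {Ω : Type*} [MeasurableSpace Ω] {P : Measure Ω} {Y : ℕ → Ω → ℝ} [IsProbabilityMeasure P]

/-- The majorant is the indicator of an atypical future plus the loss bound for a typical one. Given
the budget, the latter is at most `e` on an interval of length `4 * e`, so its mean is at most `4 *
e ^ 2`. -/
theorem exists_stepLoss_bound (hY : IsUniformSequence P Y) {T t : ℕ} (B : ℕ)
    (ht : t < firstPhase (1 / 2) T) :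
    ∃ g : Ω → ℝ, Integrable g P ∧
      (∀ᵐ ω ∂P, stepLoss (fun i => gapQuantile (Y i ω)) T (cwgQuantileRule T B fun i => Y i ω) t
        (remainingBudget B (cwgQuantileRule T B fun i => Y i ω) t) ≤ g ω) ∧
      ∫ ω, g ω ∂P ≤ (2 + 8 * Real.log T) * (1 / ((T : ℝ) - t)) := by
  have hn : 32 < T - t := by
    have := firstPhase_half_bounds.1
    unfold firstPhase at ht
    omega
  have htT : t < T := by omega
  have hnat : ((T - t : ℕ) : ℝ) = (T : ℝ) - t := by rw [Nat.cast_sub (by omega)]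
  have hn32 : 32 ≤ (T : ℝ) - t := by rw [← hnat]; exact_mod_cast hn.le
  have hnT : (T : ℝ) - t ≤ T := by linarith [(Nat.cast_nonneg t : (0 : ℝ) ≤ t)]
  set e := quantileRadius ((T : ℝ) - t) with he
  have he0 : 0 < e := quantileRadius_pos (by linarith)
  have hehalf : e < 1 / 2 := quantileRadius_lt_half hn32
  have hesq : e ^ 2 = 2 * (Real.log ((T : ℝ) - t) / ((T : ℝ) - t)) :=
    quantileRadius_sq (by linarith)
  let p : ℤ → ℝ := fun b => cwgQuantile (fun _ : Fin 1 => (1 / 2 : ℝ)) T t b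
  let φ : ℤ × ℝ → ℝ := fun z => if |z.2 - p z.1| ≤ 2 * e then e else 0
  have hφ : Measurable φ := by
    refine Measurable.ite (measurableSet_le ?_ measurable_const) measurable_const measurable_const
    exact (measurable_snd.sub ((Measurable.of_discrete (f := p)).comp measurable_fst)).abs
  have hφ0 : ∀ z, 0 ≤ φ z ∧ φ z ≤ e := fun z => by
    simp only [φ]; split_ifs
    exacts [⟨he0.le, le_rfl⟩, ⟨le_rfl, he0.le⟩]
  let f : (ℕ → ℝ) → ℤ := fun y => remainingBudget B (cwgQuantileRule T B y) t
  have hf : Measurable f := measurable_remainingBudget (measurableSet_cwgQuantileRule T B) B t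
  have hφint : Integrable (fun ω => φ (f fun i => Y i ω, Y t ω)) P := by
    refine Integrable.of_bound (hφ.comp ((hf.comp hY.measurable_path).prodMk
      (hY.measurable t))).aestronglyMeasurable e (Filter.Eventually.of_forall fun ω => ?_)
    rw [Real.norm_of_nonneg (hφ0 _).1]
    exact (hφ0 _).2
  have hφle : ∫ ω, φ (f fun i => Y i ω, Y t ω) ∂P ≤ 4 * e ^ 2 := by
    rw [hY.integral_eq_of_dependsOn hf (dependsOn_cwgQuantileRule_budget B ht) (t := t)
      (by simp) hφ hφint]
    have hnn : ∀ ω, 0 ≤ ∫ y in Icc (0 : ℝ) 1, φ (f fun i => Y i ω, y) :=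
      fun ω => integral_nonneg fun y => (hφ0 (_, y)).1
    have hle : ∀ ω, ∫ y in Icc (0 : ℝ) 1, φ (f fun i => Y i ω, y) ≤ 4 * e ^ 2 :=
      fun ω => setIntegral_near_le (p (f fun i => Y i ω)) e he0.le
    refine (integral_mono_of_nonneg (Filter.Eventually.of_forall hnn)
      (integrable_const (μ := P) (4 * e ^ 2)) (Filter.Eventually.of_forall hle)).trans ?_
    simp
  -- A measurable hull of the same measure makes it unnecessary to prove the event measurable.
  let bad := toMeasurable P
    {ω | ∃ b, 0 < b ∧ b < T - t ∧ ¬ FutureTypical (fun i => Y i ω) T t b}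
  have hbadm : MeasurableSet bad := measurableSet_toMeasurable _ _
  have hbad : P.real bad ≤ 2 / ((T : ℝ) - t) := by
    have := hY.real_exists_not_futureTypical_le (T := T) (t := t) (by omega)
    rwa [Measure.real, ← measure_toMeasurable] at this
  refine ⟨fun ω => bad.indicator 1 ω + φ (f fun i => Y i ω, Y t ω),
    ((integrable_const 1).indicator hbadm).add hφint, ?_, ?_⟩
  · filter_upwards [hY.ae_mem_Ico, hY.ae_ne (1 / 2), hY.ae_gapQuantile_mem] with ω hω hne hg
    obtain ⟨b, hb⟩ := Int.eq_ofNat_of_zero_le (remainingBudget_nonneg (B := B)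
      (fun s => not_cwgQuantileRule_zero T B s fun i => Y i ω) t)
    have hfb : (f fun i => Y i ω) = b := hb
    rw [hb, hfb]
    have hrule : ∀ c : ℤ, cwgQuantileRule T B (fun i => Y i ω) t c ↔ p c ≤ Y t ω ∧ 0 < c := by
      intro c
      simp only [cwgQuantileRule, thresholdRule, if_pos ht, p]
    have hind0 : 0 ≤ bad.indicator (1 : Ω → ℝ) ω :=
      Set.indicator_nonneg (fun _ _ => zero_le_one) ω
    have hnn : 0 ≤ bad.indicator (1 : Ω → ℝ) ω + φ ((b : ℤ), Y t ω) :=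
      add_nonneg hind0 (hφ0 _).1
    rcases Nat.eq_zero_or_pos b with rfl | hb0
    · rw [Nat.cast_zero, stepLoss_zero_of_reject (not_cwgQuantileRule_zero T B t _)]
      exact hnn
    rcases Nat.lt_or_ge b (T - t) with hbn | hbn
    · by_cases hF : FutureTypical (fun i => Y i ω) T t b
      · have := stepLoss_le_of_typical (rule := cwgQuantileRule T B fun i => Y i ω) (p := p b) htT
          hb0 hbn.le (hne t) he0 rfl (by rw [hrule]; simp [hb0]) hF
        exact this.trans (le_add_of_nonneg_left hind0)
      · have hmem : ω ∈ bad := subset_toMeasurable _ _ ⟨b, hb0, hbn, hF⟩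
        rw [Set.indicator_of_mem hmem]
        refine (stepLoss_le_one htT hg (not_cwgQuantileRule_zero T B t _)
          (Int.natCast_nonneg b)).trans ?_
        exact le_add_of_nonneg_right (hφ0 _).1
    · refine (stepLoss_nonpos_of_le htT (hg t).1 hbn ?_).trans hnn
      have hce : ceQuantile T t b ≤ 0 := by
        unfold ceQuantile
        rw [sub_nonpos, one_le_div (by linarith), ← hnat]
        exact_mod_cast hbn
      rw [hrule]
      refine ⟨?_, by exact_mod_cast hb0⟩
      simp only [p, cwgQuantile_half]
      rw [if_neg]
      · exact hce.trans (hω t).1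
      · rw [not_lt, abs_of_nonpos (by linarith)]
        linarith
  · have hsum : ∫ ω, (bad.indicator 1 ω + φ (f fun i => Y i ω, Y t ω)) ∂P =
        P.real bad + ∫ ω, φ (f fun i => Y i ω, Y t ω) ∂P := by
      rw [← integral_indicator_one hbadm]
      exact integral_add ((integrable_const 1).indicator hbadm) hφint
    rw [hsum]
    have hlog : Real.log ((T : ℝ) - t) ≤ Real.log T := Real.log_le_log (by linarith) hnT
    calc P.real bad + ∫ ω, φ (f fun i => Y i ω, Y t ω) ∂P
        ≤ 2 / ((T : ℝ) - t) + 4 * (2 * (Real.log T / ((T : ℝ) - t))) := by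
          rw [hesq] at hφle
          refine add_le_add hbad (hφle.trans ?_)
          have : 0 < (T : ℝ) - t := by linarith
          gcongr
      _ = (2 + 8 * Real.log T) * (1 / ((T : ℝ) - t)) := by ring

theorem cwg_regret_le (hY : IsUniformSequence P Y) {T B : ℕ} (hB : 1 ≤ B) (hBT : B ≤ T) :
    ∫ ω, offlineValue (fun i => gapQuantile (Y i ω)) T B ∂P -
      ∫ ω, onlineValue (fun i => gapQuantile (Y i ω)) T B (cwgQuantileRule T B fun i => Y i ω) ∂P ≤
        300 * Real.log T ^ 2 := by
  classical
  have hoff : Integrable (fun ω => offlineValue (fun i => gapQuantile (Y i ω)) T B) P :=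
    hY.integrable_topSum _ _
  have hon := hY.integrable_onlineValue (measurableSet_cwgQuantileRule T B) T B
  rw [← integral_sub hoff hon]
  rcases (show T = 1 ∨ 2 ≤ T by omega) with rfl | hT
  -- Here `log T = 0`, so the loss must vanish: there is no first phase, the threshold is 0, and the
  -- only candidate is hired.
  · obtain rfl : B = 1 := by omega
    have : ∫ ω, (offlineValue (fun i => gapQuantile (Y i ω)) 1 1 -
        onlineValue (fun i => gapQuantile (Y i ω)) 1 1 (cwgQuantileRule 1 1 fun i => Y i ω)) ∂P
          ≤ 0 := by
      refine integral_nonpos_of_ae ?_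
      filter_upwards [hY.ae_mem_Ico, hY.ae_gapQuantile_mem] with ω hω hg
      rw [offlineValue_sub_onlineValue, Finset.sum_range_one]
      refine stepLoss_nonpos_of_le one_pos (hg 0).1 le_rfl ?_
      have h0 : firstPhase (1 / 2) 1 = 0 := by
        have := firstPhase_half_bounds.1
        unfold firstPhase
        omega
      simp only [cwgQuantileRule, thresholdRule, h0, firstPhaseBudget, remainingBudget, ceQuantile]
      simpa using (hω 0).1
    simpa using this
  · set F := firstPhase (1 / 2) T with hF
    have hFT : F ≤ T := Nat.sub_le _ _
    have hTF : T ≤ F + 64 := by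
      have := firstPhase_half_bounds.2
      rw [hF]; unfold firstPhase
      omega
    have hL : 1 / 2 ≤ Real.log T := by
      have h1 := Real.log_two_gt_d9
      have h2 : Real.log 2 ≤ Real.log T := Real.log_le_log (by norm_num) (by exact_mod_cast hT)
      linarith
    choose! g hgi hga hgle using fun t (ht : t < F) => hY.exists_stepLoss_bound B ht
    have hint : Integrable (fun ω => ∑ t ∈ Finset.range F, g t ω) P :=
      integrable_finsetSum _ fun t ht => hgi t (Finset.mem_range.1 ht)
    have hga' : ∀ᵐ ω ∂P, ∀ t < F, stepLoss (fun i => gapQuantile (Y i ω)) T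
        (cwgQuantileRule T B fun i => Y i ω) t
        (remainingBudget B (cwgQuantileRule T B fun i => Y i ω) t) ≤ g t ω := by
      rw [ae_all_iff]
      intro t
      by_cases ht : t < F
      · filter_upwards [hga t ht] with ω hω _ using hω
      · exact Filter.Eventually.of_forall fun ω h => absurd h ht
    have hbound : ∫ ω, (offlineValue (fun i => gapQuantile (Y i ω)) T B -
        onlineValue (fun i => gapQuantile (Y i ω)) T B (cwgQuantileRule T B fun i => Y i ω)) ∂P ≤
          ∫ ω, ((∑ t ∈ Finset.range F, g t ω) + 64) ∂P := by
      refine integral_mono_ae (hoff.sub hon) (hint.add (integrable_const _)) ?_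
      filter_upwards [hga', hY.ae_gapQuantile_mem] with ω hω hg
      rw [offlineValue_sub_onlineValue,
        ← Finset.sum_range_add_sum_Ico _ hFT]
      refine add_le_add (Finset.sum_le_sum fun t ht => hω t (Finset.mem_range.1 ht)) ?_
      refine (Finset.sum_le_sum fun t ht => stepLoss_le_one (Finset.mem_Ico.1 ht).2 hg
        (not_cwgQuantileRule_zero T B t _) (remainingBudget_nonneg
          (fun s => not_cwgQuantileRule_zero T B s _) t)).trans ?_
      rw [Finset.sum_const, nsmul_eq_mul, mul_one, Nat.card_Ico]
      exact_mod_cast (by omega : T - F ≤ 64)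
    have hharm : ∑ t ∈ Finset.range F, 1 / ((T : ℝ) - t) ≤ 1 + Real.log T := by
      have h1 : ∑ t ∈ Finset.range F, 1 / ((T : ℝ) - t) ≤
          ∑ t ∈ Finset.range T, 1 / ((T : ℝ) - t) := by
        refine Finset.sum_le_sum_of_subset_of_nonneg (Finset.range_mono hFT) fun t ht _ => ?_
        have : (t : ℝ) < T := by exact_mod_cast Finset.mem_range.1 ht
        exact one_div_nonneg.2 (by linarith)
      have h2 : ∑ t ∈ Finset.range T, 1 / ((T : ℝ) - t) = (harmonic T : ℝ) := by
        rw [harmonic, ← Finset.sum_range_reflect]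
        push_cast
        refine Finset.sum_congr rfl fun t ht => ?_
        have := Finset.mem_range.1 ht
        rw [Nat.sub_sub, Nat.cast_sub (by omega)]
        push_cast
        rw [one_div]
        congr 1
        ring
      exact h1.trans (h2.le.trans (harmonic_le_one_add_log T))
    refine hbound.trans ?_
    rw [integral_add hint (integrable_const _), integral_finsetSum _ fun t ht =>
      hgi t (Finset.mem_range.1 ht)]
    have hsum : ∑ t ∈ Finset.range F, ∫ ω, g t ω ∂P ≤ (2 + 8 * Real.log T) * (1 + Real.log T) := by
      refine (Finset.sum_le_sum fun t ht => hgle t (Finset.mem_range.1 ht)).trans ?_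
      rw [← Finset.mul_sum]
      exact mul_le_mul_of_nonneg_left hharm (by linarith)
    simp only [integral_const, probReal_univ, smul_eq_mul, one_mul]
    -- With `L = log T ≥ 1 / 2`, the constant 300 absorbs `(2 + 8 * L) * (1 + L) + 64` into a
    -- multiple of `L ^ 2`.
    nlinarith

end IsUniformSequence

/-! ### Budget paths of CE and the cost of low hires -/

/-- The certainty equivalent policy in terms of the quantiles `y` of the candidates. -/
noncomputable def ceQuantileRule (T : ℕ) (y : ℕ → ℝ) : HiringRule := fun t b => ceQuantile T t b ≤ y t

theorem measurableSet_ceQuantileRule (T t : ℕ) (b : ℤ) :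
    MeasurableSet {y | ceQuantileRule T y t b} :=
  measurableSet_le measurable_const (measurable_pi_apply t)

theorem dependsOn_ceQuantileRule_budget (T B t : ℕ) :
    DependsOn (fun y => remainingBudget B (ceQuantileRule T y) t) (Iio t) := by
  refine dependsOn_remainingBudget B t fun s hs b y y' h => ?_
  simp only [ceQuantileRule, h s hs]

open Classical in
/-- The candidates hired by a rule during the first `t` periods. -/
noncomputable def hiredSet (B : ℕ) (rule : HiringRule) (t : ℕ) : Finset ℕ :=
  (Finset.range t).filter fun s => rule s (remainingBudget B rule s)

theorem remainingBudget_eq_sub_card (B : ℕ) (rule : HiringRule) (t : ℕ) :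
    remainingBudget B rule t = B - (hiredSet B rule t).card := by
  induction t with
  | zero => simp [hiredSet, remainingBudget]
  | succ t ih =>
    rw [remainingBudget, hiredSet, Finset.range_add_one, Finset.filter_insert]
    split_ifs with h
    · rw [Finset.card_insert_of_notMem (by simp), ← hiredSet, ih]
      push_cast
      ring
    · rw [ih, hiredSet]

theorem onlineValue_eq_sum_hiredSet (x : ℕ → ℝ) (T B : ℕ) (rule : HiringRule) :
    onlineValue x T B rule = ∑ t ∈ hiredSet B rule T, x t := by
  rw [onlineValue, hiredSet, Finset.sum_filter]

/-- If there are at least `B` high candidates, every low candidate in a feasible selection `A` costs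
at least half a unit of value. -/
theorem sum_add_half_card_le_topSum {y : ℕ → ℝ} {A J : Finset ℕ}
    {B : ℕ} (hAJ : A ⊆ J) (hA : A.card ≤ B) (hB : B ≤ (J.filter fun i => 1 / 2 < y i).card) :
    (∑ i ∈ A, gapQuantile (y i)) + (A.filter fun i => ¬ 1 / 2 < y i).card / 2 ≤
      topSum (fun i => gapQuantile (y i)) J B := by
  -- Keep the high candidates of `A` and fill up to `B` with other high ones: each low candidate,
  -- worth at most 1/4, is matched by an added one worth at least 3/4.
  obtain ⟨s, hs1, hs2, hs3⟩ := Finset.exists_subsuperset_card_eq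
    (Finset.filter_subset_filter (fun i => 1 / 2 < y i) hAJ)
    ((Finset.card_filter_le A _).trans hA) hB
  have h1 : ∑ i ∈ s, gapQuantile (y i) ≤ topSum (fun i => gapQuantile (y i)) J B :=
    sum_le_topSum (hs2.trans (Finset.filter_subset _ _)) hs3.le
  have hcard := Finset.card_filter_add_card_filter_not (s := A) (fun i => 1 / 2 < y i)
  have hcard' : (A.filter fun i => ¬ 1 / 2 < y i).card ≤
      (s \ A.filter fun i => 1 / 2 < y i).card := by
    rw [Finset.card_sdiff_of_subset hs1]
    omega
  have hlow : ∑ i ∈ A.filter (fun i => ¬ 1 / 2 < y i), gapQuantile (y i) ≤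
      (A.filter fun i => ¬ 1 / 2 < y i).card * (1 / 4) := by
    rw [← nsmul_eq_mul]
    refine Finset.sum_le_card_nsmul _ _ _ fun i hi => ?_
    have := (Finset.mem_filter.1 hi).2
    simp only [gapQuantile, if_neg this]
    linarith
  have hhigh : ((s \ A.filter fun i => 1 / 2 < y i).card : ℝ) * (3 / 4) ≤
      ∑ i ∈ s \ A.filter (fun i => 1 / 2 < y i), gapQuantile (y i) := by
    rw [← nsmul_eq_mul]
    refine Finset.card_nsmul_le_sum _ _ _ fun i hi => ?_
    have := (Finset.mem_filter.1 (hs2 (Finset.mem_sdiff.1 hi).1)).2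
    simp only [gapQuantile, if_pos this]
    linarith
  have e1 := Finset.sum_filter_add_sum_filter_not A (fun i => 1 / 2 < y i)
    fun i => gapQuantile (y i)
  have e2 := Finset.sum_sdiff (f := fun i => gapQuantile (y i)) hs1
  have hcard'' : ((A.filter fun i => ¬ 1 / 2 < y i).card : ℝ) ≤
      (s \ A.filter fun i => 1 / 2 < y i).card := by exact_mod_cast hcard'
  linarith

/-- The rule has no explicit budget check. At budget 0 the threshold is 1, which no quantile in `[0,
1)` reaches; at budget `T - t` it is 0, so everyone is hired. -/
theorem ceQuantileRule_budget_bounds {T B : ℕ} (hB : B ≤ T) {y : ℕ → ℝ}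
    (hy : ∀ i, y i ∈ Ico (0 : ℝ) 1) {t : ℕ} (ht : t ≤ T) :
    0 ≤ remainingBudget B (ceQuantileRule T y) t ∧
      remainingBudget B (ceQuantileRule T y) t ≤ (T : ℤ) - t := by
  induction t with
  | zero => simp only [remainingBudget]; omega
  | succ t ih =>
    obtain ⟨h0, h1⟩ := ih (by omega)
    rw [remainingBudget]
    have hpos : (0 : ℝ) < (T : ℝ) - t := by
      have : (t : ℝ) < T := by exact_mod_cast ht
      linarith
    split_ifs with h
    · have : remainingBudget B (ceQuantileRule T y) t ≠ 0 := by
        intro h0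
        rw [h0] at h
        simp only [ceQuantileRule, ceQuantile, Int.cast_zero, zero_div, sub_zero] at h
        linarith [(hy t).2]
      push_cast
      omega
    · have : remainingBudget B (ceQuantileRule T y) t ≠ (T : ℤ) - t := by
        intro h0
        rw [h0] at h
        apply h
        simp only [ceQuantileRule, ceQuantile]
        push_cast
        rw [div_self hpos.ne', sub_self]
        exact (hy t).1
      push_cast
      omega

theorem ceQuantile_mem_Icc {T t : ℕ} {b : ℤ} (ht : t < T) (h0 : 0 ≤ b) (h1 : b ≤ (T : ℤ) - t) :
    ceQuantile T t b ∈ Icc (0 : ℝ) 1 := by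
  have hpos : (0 : ℝ) < (T : ℝ) - t := by
    have : (t : ℝ) < T := by exact_mod_cast ht
    linarith
  have h0' : (0 : ℝ) ≤ b := by exact_mod_cast h0
  have h1' : (b : ℝ) ≤ (T : ℝ) - t := by exact_mod_cast h1
  unfold ceQuantile
  have h2 : (b : ℝ) / ((T : ℝ) - t) ≤ 1 := (div_le_one hpos).2 h1'
  have h3 : 0 ≤ (b : ℝ) / ((T : ℝ) - t) := div_nonneg h0' hpos.le
  constructor <;> linarith

-- The increment is the hiring indicator minus its conditional mean, divided by the number of
-- periods left after this one: this is the martingale structure of CE.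
open Classical in
theorem ceQuantile_succ {T t : ℕ} (ht : t + 1 < T) (B : ℕ) (y : ℕ → ℝ) :
    ceQuantile T (t + 1) (remainingBudget B (ceQuantileRule T y) (t + 1)) =
      ceQuantile T t (remainingBudget B (ceQuantileRule T y) t) +
        ((if ceQuantile T t (remainingBudget B (ceQuantileRule T y) t) ≤ y t then 1 else 0) -
          (1 - ceQuantile T t (remainingBudget B (ceQuantileRule T y) t))) / ((T : ℝ) - t - 1) := by
  have hpos : (0 : ℝ) < (T : ℝ) - t - 1 := by
    have : (t : ℝ) + 1 < T := by exact_mod_cast ht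
    linarith
  have h1 : (T : ℝ) - t ≠ 0 := by linarith
  have h2 : (T : ℝ) - ((t + 1 : ℕ) : ℝ) = (T : ℝ) - t - 1 := by push_cast; ring
  rw [remainingBudget]
  set b := remainingBudget B (ceQuantileRule T y) t
  change ceQuantile T (t + 1) (if ceQuantile T t b ≤ y t then b - 1 else b) = _
  split_ifs
  · unfold ceQuantile
    rw [h2]
    push_cast
    field_simp
    ring
  · unfold ceQuantile
    rw [h2]
    field_simp
    ring

theorem setIntegral_indicator_sub {p : ℝ} (hp : p ∈ Icc (0 : ℝ) 1) :
    ∫ y in Icc (0 : ℝ) 1, ((if p ≤ y then 1 else 0) - (1 - p)) = 0 := by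
  have h : (fun y : ℝ => if p ≤ y then (1 : ℝ) else 0) = (Ici p).indicator 1 := by
    funext y; simp [Set.indicator_apply]
  have hint : IntegrableOn (fun y : ℝ => if p ≤ y then (1 : ℝ) else 0) (Icc 0 1) := by
    rw [h]; exact (integrable_const (1 : ℝ)).indicator measurableSet_Ici
  rw [integral_sub hint (integrable_const _), h, integral_indicator_one measurableSet_Ici,
    measureReal_restrict_apply measurableSet_Ici]
  have : Ici p ∩ Icc 0 1 = Icc p 1 := by
    ext y
    simp only [mem_inter_iff, mem_Ici, mem_Icc]
    exact ⟨fun h => ⟨h.1, h.2.2⟩, fun h => ⟨h.1, hp.1.trans h.1, h.2⟩⟩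
  rw [this, Measure.real, Real.volume_Icc, ENNReal.toReal_ofReal (by linarith [hp.2])]
  simp

/-! ### Fluctuations of the number of high candidates -/

/-- `1 / 2` for a high candidate, `-1 / 2` for a low one. -/
noncomputable def highSign (y : ℝ) : ℝ := if 1 / 2 < y then 1 / 2 else -1 / 2

theorem measurable_highSign : Measurable highSign :=
  Measurable.ite measurableSet_Ioi measurable_const measurable_const

theorem highSign_sq (y : ℝ) : highSign y ^ 2 = 1 / 4 := by
  unfold highSign; split_ifs <;> norm_num

theorem setIntegral_highSign : ∫ y in Icc (0 : ℝ) 1, highSign y = 0 := by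
  have h0 := setIntegral_indicator_sub (p := 1 / 2) ⟨by norm_num, by norm_num⟩
  refine Eq.trans (integral_congr_ae ?_) h0
  filter_upwards [ae_restrict_of_ae (Measure.ae_ne volume (1 / 2 : ℝ))] with y hy
  unfold highSign
  rcases lt_or_gt_of_ne hy with h | h
  · rw [if_neg (by linarith), if_neg (by linarith)]; norm_num
  · rw [if_pos h, if_pos h.le]; norm_num

theorem sum_highSign (y : ℕ → ℝ) (T : ℕ) :
    ∑ i ∈ Finset.range T, highSign (y i) =
      ((Finset.range T).filter fun i => 1 / 2 < y i).card - (T : ℝ) / 2 := by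
  have : ∀ i, highSign (y i) = (if 1 / 2 < y i then 1 else 0) - 1 / 2 := fun i => by
    unfold highSign; split_ifs <;> norm_num
  simp only [this, Finset.sum_sub_distrib, Finset.sum_boole]
  simp
  ring

theorem abs_sum_highSign_le (y : ℕ → ℝ) (T : ℕ) : |∑ i ∈ Finset.range T, highSign (y i)| ≤ T := by
  refine (Finset.abs_sum_le_sum_abs _ _).trans ?_
  refine (Finset.sum_le_card_nsmul _ _ 1 fun i _ => ?_).trans (by simp)
  unfold highSign
  split_ifs <;> norm_num [abs_le]

theorem measurable_sum_highSign (T : ℕ) :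
    Measurable fun y : ℕ → ℝ => ∑ i ∈ Finset.range T, highSign (y i) :=
  Finset.measurable_sum _ fun i _ => measurable_highSign.comp (measurable_pi_apply i)

/-- A quartic polynomial below the indicator of a half-line, up to scaling. -/
theorem quartic_le (w : ℝ) :
    w + w ^ 2 - 4 / 27 * w ^ 4 - 1 / 9 ≤ if 1 / 10 ≤ w then 4 else 0 := by
  split_ifs with h
  -- The quartic stays below 4 everywhere; its maximum is near `w = 2`.
  · nlinarith [sq_nonneg (w ^ 2 - 4.2), sq_nonneg (w - 2)]
  · rcases le_or_gt 0 w with h0 | h0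
    · nlinarith [pow_nonneg h0 4]
    · rcases le_or_gt (-3) w with h3 | h3
      -- The coefficient 4/27 gives `1 + w - 4 / 27 * w ^ 3` a double root at `-3 / 2`, so the
      -- quartic without its constant is nonpositive for negative `w`.
      · have : 0 ≤ -w * ((-w - 3 / 2) ^ 2 * (-w + 3)) :=
          mul_nonneg (by linarith) (mul_nonneg (sq_nonneg _) (by linarith))
        nlinarith
      · have : 0 ≤ -w * ((-w - 3 / 2) ^ 2 * (-w + 3)) :=
          mul_nonneg (by linarith) (mul_nonneg (sq_nonneg _) (by linarith))
        nlinarith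

namespace IsUniformSequence

variable {Ω : Type*} [MeasurableSpace Ω] {P : Measure Ω} {Y : ℕ → Ω → ℝ} [IsProbabilityMeasure P]

theorem integral_mul_highSign (hY : IsUniformSequence P Y) (t : ℕ) {h : ℝ → ℝ} (hh : Measurable h)
    (hint : Integrable (fun ω => h (∑ i ∈ Finset.range t, highSign (Y i ω))) P) :
    ∫ ω, h (∑ i ∈ Finset.range t, highSign (Y i ω)) * highSign (Y t ω) ∂P = 0 := by
  have key := hY.integral_eq_of_dependsOn (measurable_sum_highSign t) (s := Iio t)
    (fun y y' hyy => Finset.sum_congr rfl fun i hi => by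
      rw [hyy i (Finset.mem_range.1 hi)]) (t := t) (by simp)
    (φ := fun z => h z.1 * highSign z.2)
    ((hh.comp measurable_fst).mul (measurable_highSign.comp measurable_snd))
    (hint.mul_bdd (c := 1) (measurable_highSign.comp (hY.measurable t)).aestronglyMeasurable
      (Filter.Eventually.of_forall fun ω => by
        unfold highSign; split_ifs <;> norm_num))
  rw [key]
  simp only [integral_const_mul, setIntegral_highSign, mul_zero, integral_zero]

theorem integrable_pow_sum_highSign (hY : IsUniformSequence P Y) (t k : ℕ) :
    Integrable (fun ω => (∑ i ∈ Finset.range t, highSign (Y i ω)) ^ k) P := by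
  refine Integrable.of_bound (((measurable_sum_highSign t).comp
    hY.measurable_path).pow_const k).aestronglyMeasurable ((t : ℝ) ^ k)
    (Filter.Eventually.of_forall fun ω => ?_)
  rw [norm_pow, Real.norm_eq_abs]
  exact pow_le_pow_left₀ (abs_nonneg _) (abs_sum_highSign_le _ t) k

/-- Expand the power of `W + z` with `z ^ 2 = 1 / 4`; odd powers of the new sign `z` integrate to
zero by independence. -/
theorem integral_pow_sum_highSign (hY : IsUniformSequence P Y) (t : ℕ) :
    ∫ ω, (∑ i ∈ Finset.range t, highSign (Y i ω)) ∂P = 0 ∧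
      ∫ ω, (∑ i ∈ Finset.range t, highSign (Y i ω)) ^ 2 ∂P = (t : ℝ) / 4 ∧
      ∫ ω, (∑ i ∈ Finset.range t, highSign (Y i ω)) ^ 4 ∂P ≤ 3 * (t : ℝ) ^ 2 / 16 := by
  induction t with
  | zero => simp
  | succ t ih =>
    obtain ⟨ih1, ih2, ih4⟩ := ih
    have hi := hY.integrable_pow_sum_highSign t
    have hcross : ∀ k, Integrable (fun ω =>
        (∑ i ∈ Finset.range t, highSign (Y i ω)) ^ k * highSign (Y t ω)) P := fun k =>
      (hi k).mul_bdd (c := 1) (measurable_highSign.comp (hY.measurable t)).aestronglyMeasurable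
        (Filter.Eventually.of_forall fun ω => by
          unfold highSign; split_ifs <;> norm_num)
    have hz : ∀ k, ∫ ω, (∑ i ∈ Finset.range t, highSign (Y i ω)) ^ k * highSign (Y t ω) ∂P = 0 :=
      fun k => hY.integral_mul_highSign t (h := fun x => x ^ k) (measurable_id.pow_const k) (hi k)
    simp only [Finset.sum_range_succ]
    refine ⟨?_, ?_, ?_⟩
    · have e : ∀ ω, (∑ i ∈ Finset.range t, highSign (Y i ω)) + highSign (Y t ω) =
          (∑ i ∈ Finset.range t, highSign (Y i ω)) ^ 1 +
            (∑ i ∈ Finset.range t, highSign (Y i ω)) ^ 0 * highSign (Y t ω) := fun ω => by ring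
      simp only [e]
      rw [integral_add (hi 1) (hcross 0), hz 0]
      simpa using ih1
    · have e : ∀ ω, ((∑ i ∈ Finset.range t, highSign (Y i ω)) + highSign (Y t ω)) ^ 2 =
          (∑ i ∈ Finset.range t, highSign (Y i ω)) ^ 2 +
            2 * ((∑ i ∈ Finset.range t, highSign (Y i ω)) ^ 1 * highSign (Y t ω)) + 1 / 4 :=
        fun ω => by rw [← highSign_sq (Y t ω)]; ring
      simp only [e]
      have I1 : Integrable (fun ω => (∑ i ∈ Finset.range t, highSign (Y i ω)) ^ 2 +
          2 * ((∑ i ∈ Finset.range t, highSign (Y i ω)) ^ 1 * highSign (Y t ω))) P :=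
        (hi 2).add ((hcross 1).const_mul 2)
      rw [integral_add I1 (integrable_const _),
        integral_add (hi 2) ((hcross 1).const_mul 2), integral_const_mul, hz 1, ih2]
      simp
      ring
    · have e : ∀ ω, ((∑ i ∈ Finset.range t, highSign (Y i ω)) + highSign (Y t ω)) ^ 4 =
          (∑ i ∈ Finset.range t, highSign (Y i ω)) ^ 4 +
            4 * ((∑ i ∈ Finset.range t, highSign (Y i ω)) ^ 3 * highSign (Y t ω)) +
            3 / 2 * (∑ i ∈ Finset.range t, highSign (Y i ω)) ^ 2 +
            ((∑ i ∈ Finset.range t, highSign (Y i ω)) ^ 1 * highSign (Y t ω)) + 1 / 16 :=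
        fun ω => by
          have := highSign_sq (Y t ω)
          generalize highSign (Y t ω) = z at this
          generalize (∑ i ∈ Finset.range t, highSign (Y i ω)) = W
          linear_combination (6 * W ^ 2 + 4 * W * z + z ^ 2 + 1 / 4) * this
      simp only [e]
      have I1 : Integrable (fun ω => (∑ i ∈ Finset.range t, highSign (Y i ω)) ^ 4 +
          4 * ((∑ i ∈ Finset.range t, highSign (Y i ω)) ^ 3 * highSign (Y t ω))) P :=
        (hi 4).add ((hcross 3).const_mul 4)
      have I2 : Integrable (fun ω => (∑ i ∈ Finset.range t, highSign (Y i ω)) ^ 4 +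
          4 * ((∑ i ∈ Finset.range t, highSign (Y i ω)) ^ 3 * highSign (Y t ω)) +
          3 / 2 * (∑ i ∈ Finset.range t, highSign (Y i ω)) ^ 2) P :=
        I1.add ((hi 2).const_mul _)
      have I3 : Integrable (fun ω => (∑ i ∈ Finset.range t, highSign (Y i ω)) ^ 4 +
          4 * ((∑ i ∈ Finset.range t, highSign (Y i ω)) ^ 3 * highSign (Y t ω)) +
          3 / 2 * (∑ i ∈ Finset.range t, highSign (Y i ω)) ^ 2 +
          (∑ i ∈ Finset.range t, highSign (Y i ω)) ^ 1 * highSign (Y t ω)) P :=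
        I2.add (hcross 1)
      rw [integral_add I3 (integrable_const _), integral_add I2 (hcross 1),
        integral_add I1 ((hi 2).const_mul _),
        integral_add (hi 4) ((hcross 3).const_mul 4), integral_const_mul, integral_const_mul,
        hz 3, hz 1, ih2]
      simp
      nlinarith

/-- The number of high candidates exceeds its mean by `√T / 20` with probability at least `1 / 9`. -/
theorem one_ninth_le_real_sum_highSign (hY : IsUniformSequence P Y) {T : ℕ} (hT : 0 < T) :
    1 / 9 ≤ P.real {ω | √T / 20 ≤ ∑ i ∈ Finset.range T, highSign (Y i ω)} := by
  obtain ⟨h1, h2, h4⟩ := hY.integral_pow_sum_highSign T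
  have hi := hY.integrable_pow_sum_highSign T
  have hT' : (0 : ℝ) < T := by exact_mod_cast hT
  have hs : 0 < √(T : ℝ) := Real.sqrt_pos.2 hT'
  have hs2 : √(T : ℝ) ^ 2 = T := Real.sq_sqrt hT'.le
  set S : Set Ω := {ω | √T / 20 ≤ ∑ i ∈ Finset.range T, highSign (Y i ω)} with hS
  have hSm : MeasurableSet S :=
    measurableSet_le measurable_const ((measurable_sum_highSign T).comp hY.measurable_path)
  have hint := (((hi 1).const_mul (2 / √T)).add ((hi 2).const_mul (4 / T))).sub
    (((hi 4).const_mul (64 / (27 * (T : ℝ) ^ 2))).add (integrable_const (1 / 9)))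
  have hle := integral_mono hint (((integrable_const (1 : ℝ)).indicator hSm).const_mul 4)
    (fun ω => by
      -- The normalized sum `w` has mean 0, variance 1 and fourth moment at most 3, so the quartic
      -- has mean at least `1 - 4 / 9 - 1 / 9 = 4 / 9`, while it is at most 4 times the indicator.
      have hq := quartic_le (2 / √T * ∑ i ∈ Finset.range T, highSign (Y i ω))
      have e : S.indicator (fun _ => (1 : ℝ)) ω = if 1 / 10 ≤ 2 / √T *
          ∑ i ∈ Finset.range T, highSign (Y i ω) then 1 else 0 := by
        simp only [Set.indicator_apply, hS, mem_ofPred_eq]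
        congr 1
        rw [div_mul_eq_mul_div, le_div_iff₀ hs]
        exact propext ⟨fun h => by linarith, fun h => by linarith⟩
      simp only [Pi.add_apply, Pi.sub_apply, e, mul_ite, mul_one, mul_zero]
      refine le_trans (le_of_eq ?_) hq
      generalize (∑ i ∈ Finset.range T, highSign (Y i ω)) = W
      generalize √(T : ℝ) = s at hs hs2 ⊢
      rw [← hs2]
      field_simp
      ring)
  rw [integral_sub' ((( hi 1).const_mul _).add ((hi 2).const_mul _))
      (((hi 4).const_mul _).add (integrable_const _)),
    integral_add' ((hi 1).const_mul _) ((hi 2).const_mul _),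
    integral_add' ((hi 4).const_mul _) (integrable_const _), integral_const_mul,
    integral_const_mul, integral_const_mul, integral_const_mul] at hle
  have hind : ∫ ω, S.indicator (fun _ => (1 : ℝ)) ω ∂P = P.real S := integral_indicator_one hSm
  rw [hind, h2] at hle
  simp only [pow_one, h1, integral_const, probReal_univ, smul_eq_mul, one_mul] at hle
  have h4' : 64 / (27 * (T : ℝ) ^ 2) *
      ∫ ω, (∑ i ∈ Finset.range T, highSign (Y i ω)) ^ 4 ∂P ≤ 4 / 9 := by
    refine (mul_le_mul_of_nonneg_left h4 (by positivity)).trans (le_of_eq ?_)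
    field_simp
    norm_num
  have h2' : 4 / (T : ℝ) * (T / 4) = 1 := by field_simp
  rw [h2'] at hle
  linarith

/-! ### Early stability of CE and its square-root regret -/

/-- The certainty-equivalent quantile is a martingale with increments of order `1 / T`. -/
theorem integral_sq_ceQuantile_sub_le (hY : IsUniformSequence P Y) {T B : ℕ} (hB : B ≤ T) {t : ℕ}
    (ht : 2 * t ≤ T) (hT : 3 ≤ T) :
    ∫ ω, (ceQuantile T t (remainingBudget B (ceQuantileRule T fun i => Y i ω) t) -
      ceQuantile T 0 B) ^ 2 ∂P ≤ 4 * t / (T : ℝ) ^ 2 := by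
  classical
  induction t with
  | zero => simp [remainingBudget]
  | succ t ih =>
    have hpos : (T : ℝ) / 2 ≤ (T : ℝ) - t - 1 := by
      have : 2 * ((t : ℝ) + 1) ≤ T := by exact_mod_cast ht
      linarith
    have hT0 : (3 : ℝ) ≤ T := by exact_mod_cast hT
    set n : ℝ := (T : ℝ) - t - 1 with hn
    have hn0 : 0 < n := by linarith
    let f : (ℕ → ℝ) → ℤ := fun y => remainingBudget B (ceQuantileRule T y) t
    have hf : Measurable f := measurable_remainingBudget (measurableSet_ceQuantileRule T) B t
    have hfY : Measurable fun ω => f fun i => Y i ω := hf.comp hY.measurable_path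
    let ψ : ℤ → ℝ := fun b => ceQuantile T t b - ceQuantile T 0 B
    let d : ℤ × ℝ → ℝ := fun z =>
      ((if ceQuantile T t z.1 ≤ z.2 then 1 else 0) - (1 - ceQuantile T t z.1)) / n
    have hq : Measurable fun z : ℤ × ℝ => ceQuantile T t z.1 :=
      (Measurable.of_discrete (f := fun b : ℤ => ceQuantile T t b)).comp measurable_fst
    have hd : Measurable d :=
      ((Measurable.ite (measurableSet_le hq measurable_snd) measurable_const
        measurable_const).sub (measurable_const.sub hq)).div_const n
    have hψ : Measurable ψ := Measurable.of_discrete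
    have hdY : Measurable fun ω => d (f fun i => Y i ω, Y t ω) :=
      hd.comp (hfY.prodMk (hY.measurable t))
    have hq01 : ∀ᵐ ω ∂P, ceQuantile T t (f fun i => Y i ω) ∈ Icc (0 : ℝ) 1 := by
      filter_upwards [hY.ae_mem_Ico] with ω hω
      have := ceQuantileRule_budget_bounds hB hω (t := t) (by omega)
      exact ceQuantile_mem_Icc (by omega) this.1 this.2
    have hq0 : ceQuantile T 0 B ∈ Icc (0 : ℝ) 1 :=
      ceQuantile_mem_Icc (by omega) (by omega) (by push_cast; omega)
    have hψb : ∀ᵐ ω ∂P, ‖ψ (f fun i => Y i ω)‖ ≤ 1 := by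
      filter_upwards [hq01] with ω hω
      rw [Real.norm_eq_abs, abs_le]
      exact ⟨by linarith [hω.1, hq0.2], by linarith [hω.2, hq0.1]⟩
    have hdb : ∀ᵐ ω ∂P, ‖d (f fun i => Y i ω, Y t ω)‖ ≤ 1 / n := by
      filter_upwards [hq01] with ω hω
      simp only [d]
      rw [Real.norm_eq_abs, abs_div, abs_of_pos hn0]
      refine div_le_div_of_nonneg_right ?_ hn0.le
      rw [abs_le]
      split_ifs
      · exact ⟨by linarith [hω.1, hω.2], by linarith [hω.1, hω.2]⟩
      · exact ⟨by linarith [hω.1, hω.2], by linarith [hω.1, hω.2]⟩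
    have hi1 : Integrable (fun ω => ψ (f fun i => Y i ω)) P :=
      Integrable.of_bound (hψ.comp hfY).aestronglyMeasurable 1 hψb
    have hi2 : Integrable (fun ω => ψ (f fun i => Y i ω) ^ 2) P := by
      refine Integrable.of_bound ((hψ.comp hfY).pow_const 2).aestronglyMeasurable 1 ?_
      filter_upwards [hψb] with ω hω
      rw [norm_pow]
      exact pow_le_one₀ (norm_nonneg _) hω
    have hi3 : Integrable (fun ω => ψ (f fun i => Y i ω) * d (f fun i => Y i ω, Y t ω)) P :=
      hi1.mul_bdd hdY.aestronglyMeasurable hdb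
    -- Orthogonality of martingale increments: given the past budget, `d` has mean zero.
    have hz : ∫ ω, ψ (f fun i => Y i ω) * d (f fun i => Y i ω, Y t ω) ∂P = 0 := by
      rw [hY.integral_eq_of_dependsOn hf (dependsOn_ceQuantileRule_budget T B t) (t := t) (by simp)
        (φ := fun z => ψ z.1 * d z) ((hψ.comp measurable_fst).mul hd) hi3]
      refine integral_eq_zero_of_ae ?_
      filter_upwards [hq01] with ω hω
      simp only [d, integral_const_mul, integral_div, setIntegral_indicator_sub hω]
      simp
    -- In the first half of the horizon at least `T / 2` periods follow, so increments are at most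
    -- `2 / T`.
    have hsq : ∀ᵐ ω ∂P, d (f fun i => Y i ω, Y t ω) ^ 2 ≤ 4 / (T : ℝ) ^ 2 := by
      filter_upwards [hdb] with ω hω
      have h1 : d (f fun i => Y i ω, Y t ω) ^ 2 ≤ (1 / n) ^ 2 := by
        rw [← sq_abs]
        exact pow_le_pow_left₀ (abs_nonneg _) hω 2
      have h2 : (1 / n) ^ 2 ≤ (1 / ((T : ℝ) / 2)) ^ 2 :=
        pow_le_pow_left₀ (by positivity) (one_div_le_one_div_of_le (by linarith) hpos) 2
      refine h1.trans (h2.trans (le_of_eq ?_))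
      field_simp
      norm_num
    have hmono : ∫ ω, (ceQuantile T (t + 1)
          (remainingBudget B (ceQuantileRule T fun i => Y i ω) (t + 1)) - ceQuantile T 0 B) ^ 2 ∂P ≤
        ∫ ω, (ψ (f fun i => Y i ω) ^ 2 + 2 * (ψ (f fun i => Y i ω) * d (f fun i => Y i ω, Y t ω)) +
          4 / (T : ℝ) ^ 2) ∂P := by
      refine integral_mono_of_nonneg (Filter.Eventually.of_forall fun ω => sq_nonneg _)
        ((hi2.add (hi3.const_mul 2)).add (integrable_const _)) ?_
      filter_upwards [hsq] with ω hω
      rw [ceQuantile_succ (by omega)]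
      have e : ceQuantile T t (remainingBudget B (ceQuantileRule T fun i => Y i ω) t) +
          ((if ceQuantile T t (remainingBudget B (ceQuantileRule T fun i => Y i ω) t) ≤ Y t ω
            then 1 else 0) -
          (1 - ceQuantile T t (remainingBudget B (ceQuantileRule T fun i => Y i ω) t))) /
            ((T : ℝ) - t - 1) - ceQuantile T 0 B =
          ψ (f fun i => Y i ω) + d (f fun i => Y i ω, Y t ω) := by
        simp only [ψ, d, f, hn]
        ring
      rw [e]
      nlinarith
    refine hmono.trans ?_
    have I1 : Integrable (fun ω => ψ (f fun i => Y i ω) ^ 2 +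
        2 * (ψ (f fun i => Y i ω) * d (f fun i => Y i ω, Y t ω))) P := hi2.add (hi3.const_mul 2)
    rw [integral_add I1 (integrable_const _),
      integral_add hi2 (hi3.const_mul 2), integral_const_mul, hz]
    have := ih (by omega)
    simp only [integral_const, probReal_univ, smul_eq_mul, one_mul, mul_zero, add_zero]
    calc _ ≤ 4 * (t : ℝ) / (T : ℝ) ^ 2 + 4 / (T : ℝ) ^ 2 := add_le_add this le_rfl
      _ = 4 * ((t + 1 : ℕ) : ℝ) / (T : ℝ) ^ 2 := by push_cast; ring

end IsUniformSequence

/-- A budget slightly above `T / 2`, for which the certainty equivalent policy is far from optimal. -/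
noncomputable def hardBudget (T : ℕ) : ℕ := ⌊(T : ℝ) / 2 + √T / 20⌋₊ - 1

theorem hardBudget_bounds {T : ℕ} (hT : 180000 ≤ T) :
    1 ≤ hardBudget T ∧ hardBudget T ≤ T ∧ (T : ℝ) / 2 + √T / 25 ≤ hardBudget T ∧
      (hardBudget T : ℝ) + 1 ≤ T / 2 + √T / 20 := by
  have hT' : (180000 : ℝ) ≤ T := by exact_mod_cast hT
  have hs : 400 ≤ √(T : ℝ) := Real.le_sqrt_of_sq_le (by linarith)
  have hs2 : √(T : ℝ) ^ 2 = T := Real.sq_sqrt (by linarith)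
  have h1 := Nat.floor_le (show 0 ≤ (T : ℝ) / 2 + √T / 20 by positivity)
  have h2 := Nat.lt_floor_add_one ((T : ℝ) / 2 + √T / 20)
  have h3 : 2 ≤ ⌊(T : ℝ) / 2 + √T / 20⌋₊ := Nat.le_floor (by push_cast; linarith)
  have h4 : (hardBudget T : ℝ) = ⌊(T : ℝ) / 2 + √T / 20⌋₊ - 1 := by
    rw [hardBudget, Nat.cast_sub (by omega), Nat.cast_one]
  refine ⟨by unfold hardBudget; omega, ?_, by rw [h4]; linarith, by rw [h4]; linarith⟩
  have : (hardBudget T : ℝ) ≤ T := by rw [h4]; nlinarith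
  exact_mod_cast this

namespace IsUniformSequence

variable {Ω : Type*} [MeasurableSpace Ω] {P : Measure Ω} {Y : ℕ → Ω → ℝ} [IsProbabilityMeasure P]

theorem real_ceQuantile_sub_ge_le (hY : IsUniformSequence P Y) {T B : ℕ} (hB : B ≤ T) {t : ℕ}
    (ht : 2 * t ≤ T) (hT : 3 ≤ T) {s : ℝ} (hs : 0 < s) :
    P.real {ω | s ≤ ceQuantile T t (remainingBudget B (ceQuantileRule T fun i => Y i ω) t) -
      ceQuantile T 0 B} ≤ 4 * t / (T : ℝ) ^ 2 / s ^ 2 := by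
  have hm : Measurable fun ω =>
      ceQuantile T t (remainingBudget B (ceQuantileRule T fun i => Y i ω) t) - ceQuantile T 0 B :=
    ((Measurable.of_discrete (f := fun b : ℤ => ceQuantile T t b - ceQuantile T 0 B)).comp
      (measurable_remainingBudget (measurableSet_ceQuantileRule T) B t)).comp hY.measurable_path
  have hint : Integrable (fun ω =>
      (ceQuantile T t (remainingBudget B (ceQuantileRule T fun i => Y i ω) t) -
        ceQuantile T 0 B) ^ 2) P := by
    refine Integrable.of_bound (hm.pow_const 2).aestronglyMeasurable 1 ?_
    filter_upwards [hY.ae_mem_Ico] with ω hω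
    have h1 := ceQuantileRule_budget_bounds hB hω (t := t) (by omega)
    have h2 := ceQuantile_mem_Icc (by omega) h1.1 h1.2
    have h3 : ceQuantile T 0 B ∈ Icc (0 : ℝ) 1 :=
      ceQuantile_mem_Icc (by omega) (by omega) (by push_cast; omega)
    rw [norm_pow]
    refine pow_le_one₀ (norm_nonneg _) ?_
    rw [Real.norm_eq_abs, abs_le]
    exact ⟨by linarith [h2.1, h3.2], by linarith [h2.2, h3.1]⟩
  have h := mul_meas_ge_le_integral_of_nonneg (Filter.Eventually.of_forall fun ω => sq_nonneg _)
    hint (s ^ 2)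
  rw [le_div_iff₀ (by positivity), mul_comm]
  refine le_trans (mul_le_mul_of_nonneg_left (measureReal_mono ?_) (by positivity))
    (h.trans (hY.integral_sq_ceQuantile_sub_le hB ht hT))
  intro ω hω
  exact pow_le_pow_left₀ hs.le hω 2

theorem ce_regret_ge (hY : IsUniformSequence P Y) {T : ℕ} (hT : 180000 ≤ T) :
    1 / 10 ^ 9 * √T ≤ ∫ ω, offlineValue (fun i => gapQuantile (Y i ω)) T (hardBudget T) ∂P -
      ∫ ω, onlineValue (fun i => gapQuantile (Y i ω)) T (hardBudget T)
        (ceQuantileRule T fun i => Y i ω) ∂P := by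
  classical
  obtain ⟨hB1, hBT, hBlow, hBhigh⟩ := hardBudget_bounds hT
  set B := hardBudget T
  have hT' : (180000 : ℝ) ≤ T := by exact_mod_cast hT
  have hT0 : (0 : ℝ) < T := by linarith
  have hs : 400 ≤ √(T : ℝ) := Real.le_sqrt_of_sq_le (by linarith)
  have hs2 : √(T : ℝ) ^ 2 = T := Real.sq_sqrt (by linarith)
  set s := √(T : ℝ) with hsdef
  set a : ℝ := 1 / 2 - 1 / (50 * s) with ha
  have hδ : 0 < 1 / (50 * s) := by positivity
  have hδ' : 1 / (50 * s) ≤ 1 / 2 := one_div_le_one_div_of_le (by norm_num) (by linarith)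
  -- Counting high candidates other than `t` makes this pair independent of `Y t`. The omission may
  -- lose one high candidate, which the `- 1` in `hardBudget` compensates.
  let f : ℕ → (ℕ → ℝ) → ℤ × ℕ := fun t y => (remainingBudget B (ceQuantileRule T y) t,
    (((Finset.range T).erase t).filter fun i => 1 / 2 < y i).card)
  let D : ℕ → Set (ℤ × ℕ) := fun t => {z | ceQuantile T t z.1 ≤ a ∧ B ≤ z.2}
  let S : ℕ → Set Ω := fun t => (fun ω => f t fun i => Y i ω) ⁻¹' D t ∩ Y t ⁻¹' Ico a (1 / 2)
  have hfm : ∀ t, Measurable (f t) := fun t => by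
    refine (measurable_remainingBudget (measurableSet_ceQuantileRule T) B t).prodMk ?_
    simp only [Finset.card_filter]
    exact Finset.measurable_sum _ fun i _ => Measurable.ite
      (measurableSet_lt measurable_const (measurable_pi_apply i)) measurable_const measurable_const
  have hDm : ∀ t, MeasurableSet (D t) := fun t => MeasurableSet.of_discrete
  have hSm : ∀ t, MeasurableSet (S t) := fun t =>
    (((hfm t).comp hY.measurable_path) (hDm t)).inter (hY.measurable t measurableSet_Ico)
  have hfd : ∀ t, DependsOn (f t) {t}ᶜ := fun t y y' h => by
    refine Prod.ext ?_ ?_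
    · exact dependsOn_ceQuantileRule_budget T B t fun i hi => h i (by simpa using (ne_of_lt hi))
    · simp only [f]
      congr 1
      refine Finset.filter_congr fun i hi => ?_
      rw [h i (by simpa using Finset.ne_of_mem_erase hi)]
  have hSP : ∀ t, 180000 * t ≤ T → t < T → 1 / (50 * s) * (1 / 18) ≤ P.real (S t) := by
    intro t ht htT
    have hind := (hY.indepFun_of_dependsOn (hfm t) (hfd t) (t := t)
      (by simp)).measure_inter_preimage_eq_mul (D t) (Ico a (1 / 2)) (hDm t) measurableSet_Ico
    have h1 : P.real (Y t ⁻¹' Ico a (1 / 2)) = 1 / (50 * s) := by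
      refine (hY.real_mem t measurableSet_Ico).trans ?_
      have : Ico a (1 / 2) ∩ Icc 0 1 = Ico a (1 / 2) :=
        inter_eq_left.2 fun y hy => ⟨by linarith [hy.1], by linarith [hy.2]⟩
      rw [this, Measure.real, Real.volume_Ico, ENNReal.toReal_ofReal (by linarith)]
      linarith
    have h2 : P.real (S t) = P.real ((fun ω => f t fun i => Y i ω) ⁻¹' D t) * (1 / (50 * s)) := by
      rw [← h1]
      simp only [Measure.real, S]
      rw [hind, ENNReal.toReal_mul]
    rw [h2, mul_comm]
    refine mul_le_mul_of_nonneg_right ?_ hδ.le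
    have h3 := hY.one_ninth_le_real_sum_highSign (T := T) (by omega)
    have h4 := hY.real_ceQuantile_sub_ge_le hBT (t := t) (by omega) (by omega) hδ
    -- The ratio equals `10000 * t / T`, whence the cutoff `T / 180000`; subtracting 1/18 from the
    -- probability 1/9 of many high candidates leaves 1/18.
    have h5 : 4 * (t : ℝ) / (T : ℝ) ^ 2 / (1 / (50 * s)) ^ 2 ≤ 1 / 18 := by
      have : 180000 * (t : ℝ) ≤ T := by exact_mod_cast ht
      have e : 4 * (t : ℝ) / (T : ℝ) ^ 2 / (1 / (50 * s)) ^ 2 = 10000 * t / T := by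
        rw [div_pow, mul_pow, hs2]
        field_simp
        ring
      rw [e, div_le_iff₀ hT0]
      linarith
    have h6 : P.real {ω | s / 20 ≤ ∑ i ∈ Finset.range T, highSign (Y i ω)} ≤
        P.real ((fun ω => f t fun i => Y i ω) ⁻¹' D t) +
          P.real {ω | 1 / (50 * s) ≤ ceQuantile T t
            (remainingBudget B (ceQuantileRule T fun i => Y i ω) t) - ceQuantile T 0 B} := by
      refine (measureReal_mono ?_ (measure_ne_top _ _)).trans (measureReal_union_le _ _)
      intro ω hω
      by_cases hbad : 1 / (50 * s) ≤ ceQuantile T t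
          (remainingBudget B (ceQuantileRule T fun i => Y i ω) t) - ceQuantile T 0 B
      · exact Or.inr hbad
      · refine Or.inl ⟨?_, ?_⟩
        · have hp0 : ceQuantile T 0 B ≤ 1 / 2 - 1 / (25 * s) := by
            unfold ceQuantile
            have e : 1 / (25 * s) = s / 25 / T := by rw [← hs2]; field_simp
            have : 1 / 2 + s / 25 / T ≤ (B : ℝ) / T := by
              rw [le_div_iff₀ hT0]
              field_simp
              linarith
            rw [e]
            push_cast
            rw [sub_zero]
            linarith
          have e : 1 / (25 * s) = 2 * (1 / (50 * s)) := by field_simp; norm_num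
          change ceQuantile T t (remainingBudget B (ceQuantileRule T fun i => Y i ω) t) ≤ a
          linarith
        · have hω' : s / 20 ≤ ∑ i ∈ Finset.range T, highSign (Y i ω) := hω
          rw [sum_highSign (fun i => Y i ω)] at hω'
          change B ≤ (((Finset.range T).erase t).filter fun i => 1 / 2 < Y i ω).card
          have h7 : B + 1 ≤ ((Finset.range T).filter fun i => 1 / 2 < Y i ω).card := by
            have : (B : ℝ) + 1 ≤ ((Finset.range T).filter fun i => 1 / 2 < Y i ω).card := by
              linarith
            exact_mod_cast this
          have h8 := Finset.pred_card_le_card_erase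
            (s := (Finset.range T).filter fun i => 1 / 2 < Y i ω) (a := t)
          rw [Finset.filter_erase]
          omega
    linarith
  set τ := T / 180000 with hτ
  have hτT : τ ≤ T := Nat.div_le_self _ _
  have hτ1 : (T : ℝ) / 360000 ≤ τ := by
    have : T ≤ 360000 * τ := by omega
    have : (T : ℝ) ≤ 360000 * τ := by exact_mod_cast this
    linarith
  have hoff : Integrable (fun ω => offlineValue (fun i => gapQuantile (Y i ω)) T B) P :=
    hY.integrable_topSum _ _
  have hon := hY.integrable_onlineValue (measurableSet_ceQuantileRule T) T B
  have hiS : ∀ t ∈ Finset.range τ, Integrable ((S t).indicator (fun _ => (1 : ℝ))) P :=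
    fun t _ => (integrable_const (1 : ℝ)).indicator (hSm t)
  -- Each event `S t` is a low hire on a path with at least `B` high candidates, so it accounts for
  -- half a unit of regret.
  have hpath : ∫ ω, ∑ t ∈ Finset.range τ, (S t).indicator (fun _ => (1 : ℝ)) ω ∂P ≤
      ∫ ω, 2 * (offlineValue (fun i => gapQuantile (Y i ω)) T B -
        onlineValue (fun i => gapQuantile (Y i ω)) T B (ceQuantileRule T fun i => Y i ω)) ∂P := by
    refine integral_mono_ae (integrable_finsetSum _ hiS) ((hoff.sub hon).const_mul 2) ?_
    filter_upwards [hY.ae_mem_Ico] with ω hω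
    have hA : (hiredSet B (ceQuantileRule T fun i => Y i ω) T).card ≤ B := by
      have h1 := (ceQuantileRule_budget_bounds hBT hω (le_refl T)).1
      rw [remainingBudget_eq_sub_card] at h1
      omega
    have hAs : hiredSet B (ceQuantileRule T fun i => Y i ω) T ⊆ Finset.range T :=
      Finset.filter_subset _ _
    have hcount : ∑ t ∈ Finset.range τ, (S t).indicator (fun _ => (1 : ℝ)) ω =
        ((Finset.range τ).filter fun t => ω ∈ S t).card := by
      rw [Finset.card_filter]
      push_cast
      exact Finset.sum_congr rfl fun t _ => by by_cases h : ω ∈ S t <;> simp [h]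
    rw [hcount, onlineValue_eq_sum_hiredSet, offlineValue_eq_topSum]
    rcases ((Finset.range τ).filter fun t => ω ∈ S t).eq_empty_or_nonempty with h | h
    · rw [h, Finset.card_empty, Nat.cast_zero]
      have := sum_le_topSum (x := fun i => gapQuantile (Y i ω)) hAs hA
      linarith
    · obtain ⟨t, ht⟩ := h
      have hH' : B ≤ (((Finset.range T).erase t).filter fun i => 1 / 2 < Y i ω).card :=
        (Finset.mem_filter.1 ht).2.1.2
      have hH : B ≤ ((Finset.range T).filter fun i => 1 / 2 < Y i ω).card :=
        hH'.trans (Finset.card_le_card (Finset.filter_subset_filter _ (Finset.erase_subset _ _)))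
      have h1 := sum_add_half_card_le_topSum (y := fun i => Y i ω) hAs hA hH
      have h2 : ((Finset.range τ).filter fun t => ω ∈ S t).card ≤
          ((hiredSet B (ceQuantileRule T fun i => Y i ω) T).filter
            fun i => ¬ 1 / 2 < Y i ω).card := by
        refine Finset.card_le_card fun t ht => ?_
        obtain ⟨ht1, ht2, ht3⟩ := Finset.mem_filter.1 ht
        refine Finset.mem_filter.2 ⟨Finset.mem_filter.2
          ⟨Finset.range_mono hτT ht1, ht2.1.trans ht3.1⟩, not_lt.2 ht3.2.le⟩
      have h2' : (((Finset.range τ).filter fun t => ω ∈ S t).card : ℝ) ≤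
          ((hiredSet B (ceQuantileRule T fun i => Y i ω) T).filter
            fun i => ¬ 1 / 2 < Y i ω).card := by exact_mod_cast h2
      linarith
  rw [integral_finsetSum _ hiS, integral_const_mul, integral_sub hoff hon] at hpath
  have hsum : (τ : ℝ) * (1 / (50 * s) * (1 / 18)) ≤
      ∑ t ∈ Finset.range τ, ∫ ω, (S t).indicator (fun _ => (1 : ℝ)) ω ∂P := by
    have : (τ : ℝ) * (1 / (50 * s) * (1 / 18)) =
        (Finset.range τ).card • (1 / (50 * s) * (1 / 18)) := by simp
    rw [this]
    refine Finset.card_nsmul_le_sum _ _ _ fun t ht => ?_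
    have ht' := Finset.mem_range.1 ht
    rw [show ∫ ω, (S t).indicator (fun _ => (1 : ℝ)) ω ∂P = P.real (S t) from
      integral_indicator_one (hSm t)]
    exact hSP t (by omega) (by omega)
  have hfin : 2 * (1 / 10 ^ 9 * s) ≤ (τ : ℝ) * (1 / (50 * s) * (1 / 18)) := by
    refine le_trans ?_ (mul_le_mul_of_nonneg_right hτ1 (by positivity))
    rw [← hs2]
    have : s ^ 2 / 360000 * (1 / (50 * s) * (1 / 18)) = s / 324000000 := by field_simp; norm_num
    rw [this]
    linarith
  linarith

end IsUniformSequence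

/-! ### Transfer between abilities and uniform quantiles -/

theorem volume_two_intervals :
    (volume : Measure ℝ) (Icc 0 (1 / 4) ∪ Icc (3 / 4) 1) = ENNReal.ofReal (1 / 2) := by
  rw [measure_union _ measurableSet_Icc, Real.volume_Icc, Real.volume_Icc,
    ← ENNReal.ofReal_add (by norm_num) (by norm_num)]
  · norm_num
  · rw [Set.disjoint_left]
    intro x hx hx'
    linarith [hx.2, hx'.1]

instance isProbabilityMeasure_gapUniform : IsProbabilityMeasure gapUniform :=
  cond_isProbabilityMeasure_of_finite (by rw [volume_two_intervals]; simp)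
    (by rw [volume_two_intervals]; simp)

theorem gapUniform_real (s : Set ℝ) :
    gapUniform.real s = 2 * volume.real ((Icc 0 (1 / 4) ∪ Icc (3 / 4) 1) ∩ s) := by
  rw [gapUniform, Measure.real, cond_apply (measurableSet_Icc.union measurableSet_Icc),
    volume_two_intervals, ENNReal.toReal_mul, ENNReal.toReal_inv,
    ENNReal.toReal_ofReal (by norm_num), Measure.real]
  norm_num

theorem cdf_gapUniform_low {v : ℝ} (hv : v ∈ Icc (0 : ℝ) (1 / 4)) : cdf gapUniform v = 2 * v := by
  rw [cdf_eq_real, gapUniform_real]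
  have : (Icc 0 (1 / 4) ∪ Icc (3 / 4) 1) ∩ Iic v = Icc (0 : ℝ) v := by
    ext y
    simp only [mem_inter_iff, mem_union, mem_Icc, mem_Iic]
    constructor
    · rintro ⟨h | h, h'⟩
      · exact ⟨h.1, h'⟩
      · linarith [hv.2]
    · rintro ⟨h, h'⟩
      exact ⟨Or.inl ⟨h, h'.trans hv.2⟩, h'⟩
  rw [this, Measure.real, Real.volume_Icc, ENNReal.toReal_ofReal (by linarith [hv.1])]
  ring

theorem cdf_gapUniform_high {v : ℝ} (hv : v ∈ Icc (3 / 4 : ℝ) 1) :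
    cdf gapUniform v = 2 * v - 1 := by
  rw [cdf_eq_real, gapUniform_real]
  have : (Icc 0 (1 / 4) ∪ Icc (3 / 4) 1) ∩ Iic v = Icc (0 : ℝ) (1 / 4) ∪ Icc (3 / 4) v := by
    ext y
    simp only [mem_inter_iff, mem_union, mem_Icc, mem_Iic]
    constructor
    · rintro ⟨h | h, h'⟩
      · exact Or.inl h
      · exact Or.inr ⟨h.1, h'⟩
    · rintro (h | h)
      · exact ⟨Or.inl h, by linarith [h.2, hv.1]⟩
      · exact ⟨Or.inr ⟨h.1, h.2.trans hv.2⟩, h.2⟩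
  rw [this, measureReal_union _ measurableSet_Icc (by simp) (by simp), Measure.real, Measure.real, Real.volume_Icc,
    Real.volume_Icc, ENNReal.toReal_ofReal (by norm_num),
    ENNReal.toReal_ofReal (by linarith [hv.1])]
  · ring
  · rw [Set.disjoint_left]
    intro x hx hx'
    linarith [hx.2, hx'.1]

theorem cdf_gapUniform_gapQuantile {q : ℝ} (hq : q ∈ Icc (0 : ℝ) 1) :
    cdf gapUniform (gapQuantile q) = q := by
  obtain ⟨h0, h1⟩ := hq
  unfold gapQuantile
  split_ifs with h
  · rw [cdf_gapUniform_high ⟨by linarith, by linarith⟩]; ring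
  · rw [cdf_gapUniform_low ⟨by linarith, by linarith⟩]; ring

theorem gapQuantile_cdf_gapUniform {v : ℝ}
    (hv : v ∈ Icc (0 : ℝ) (1 / 4) ∪ Ioc (3 / 4) 1) :
    cdf gapUniform v ∈ Icc (0 : ℝ) 1 ∧ gapQuantile (cdf gapUniform v) = v := by
  rcases hv with hv | hv
  · rw [cdf_gapUniform_low hv, gapQuantile, if_neg (by linarith [hv.2])]
    exact ⟨⟨by linarith [hv.1], by linarith [hv.2]⟩, by ring⟩
  · rw [cdf_gapUniform_high ⟨hv.1.le, hv.2⟩, gapQuantile, if_pos (by linarith [hv.1])]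
    exact ⟨⟨by linarith [hv.1], by linarith [hv.2]⟩, by ring⟩

theorem le_cdf_gapUniform_iff {q v : ℝ} (hq : q ∈ Icc (0 : ℝ) 1) (hv : v ∈ Icc (0 : ℝ) 1) :
    q ≤ cdf gapUniform v ↔ gapQuantile q ≤ v := by
  constructor
  · intro h
    by_contra! hlt
    -- Either `v` is a value of `gapQuantile`, or it lies in the gap up to 3/4, where the
    -- distribution function is at most 1/2, below `q`.
    have hcases : v ∈ Icc (0 : ℝ) (1 / 4) ∪ Ioc (3 / 4) 1 ∨ (v ≤ 3 / 4 ∧ 1 / 2 < q) := by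
      by_cases h1 : v ≤ 1 / 4
      · exact Or.inl (Or.inl ⟨hv.1, h1⟩)
      by_cases h2 : v ≤ 3 / 4
      · refine Or.inr ⟨h2, ?_⟩
        by_contra hq'
        rw [gapQuantile, if_neg hq'] at hlt
        linarith
      · exact Or.inl (Or.inr ⟨not_le.1 h2, hv.2⟩)
    rcases hcases with h1 | ⟨h1, h2⟩
    · obtain ⟨-, h2⟩ := gapQuantile_cdf_gapUniform h1
      rw [← h2] at hlt
      exact absurd (gapQuantile_strictMono.lt_iff_lt.1 hlt) (not_lt.2 h)
    · have h3 := monotone_cdf gapUniform h1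
      rw [cdf_gapUniform_high ⟨le_rfl, by norm_num⟩] at h3
      linarith
  · intro h
    have := monotone_cdf gapUniform h
    rwa [cdf_gapUniform_gapQuantile hq] at this

theorem quantileFn_gapUniform {q : ℝ} (hq : q ∈ Icc (0 : ℝ) 1) :
    quantileFn gapUniform q = gapQuantile q := by
  have h := gapQuantile_mem_Icc hq
  have : {v ∈ Icc (0 : ℝ) 1 | q ≤ cdf gapUniform v} = Icc (gapQuantile q) 1 := by
    ext v
    constructor
    · rintro ⟨hv, hv'⟩
      exact ⟨(le_cdf_gapUniform_iff hq hv).1 hv', hv.2⟩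
    · rintro ⟨hv, hv'⟩
      exact ⟨⟨h.1.trans hv, hv'⟩, (le_cdf_gapUniform_iff hq ⟨h.1.trans hv, hv'⟩).2 hv⟩
  rw [quantileFn, this, csInf_Icc h.2]

/-- Injectivity of `gapQuantile` leaves one quantile per ability, so the randomization is
irrelevant. The endpoint 3/4 is excluded because no quantile maps to it. -/
theorem quantileSample_gapUniform {v : ℝ} (hv : v ∈ Icc (0 : ℝ) (1 / 4) ∪ Ioc (3 / 4) 1) (u : ℝ) :
    quantileSample gapUniform v u = cdf gapUniform v := by
  obtain ⟨h1, h2⟩ := gapQuantile_cdf_gapUniform hv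
  have : quantileSet gapUniform v = {cdf gapUniform v} := by
    ext q
    constructor
    · rintro ⟨hq, hq'⟩
      rw [quantileFn_gapUniform hq, ← h2] at hq'
      exact gapQuantile_strictMono.injective hq'
    · rintro rfl
      exact ⟨h1, (quantileFn_gapUniform h1).trans h2⟩
  rw [quantileSample, this, csInf_singleton, csSup_singleton]
  ring

theorem ae_gapUniform_mem : ∀ᵐ v ∂gapUniform, v ∈ Icc (0 : ℝ) (1 / 4) ∪ Ioc (3 / 4) 1 := by
  have h1 : ∀ᵐ v ∂gapUniform, v ∈ Icc (0 : ℝ) (1 / 4) ∪ Icc (3 / 4) 1 :=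
    ae_cond_mem (measurableSet_Icc.union measurableSet_Icc)
  have h2 : ∀ᵐ v ∂gapUniform, v ≠ 3 / 4 :=
    cond_absolutelyContinuous.ae_le (Measure.ae_ne volume (3 / 4 : ℝ))
  filter_upwards [h1, h2] with v hv hne
  rcases hv with hv | hv
  · exact Or.inl hv
  · exact Or.inr ⟨lt_of_le_of_ne hv.1 hne.symm, hv.2⟩

/-- Probability integral transform: up to null sets, `cdf gapUniform v ≤ a` means `v ≤ gapQuantile
a`, an event of probability `a` for `a` in `[0, 1]`. -/
theorem map_cdf_gapUniform :
    gapUniform.map (cdf gapUniform) = (volume : Measure ℝ).restrict (Icc 0 1) := by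
  have hm : Measurable (cdf gapUniform) := (monotone_cdf gapUniform).measurable
  have : IsProbabilityMeasure (gapUniform.map (cdf gapUniform)) :=
    Measure.isProbabilityMeasure_map hm.aemeasurable
  refine Measure.ext_of_Iic _ _ fun a => ?_
  rw [← ENNReal.toReal_eq_toReal_iff' (measure_ne_top _ _) (measure_ne_top _ _)]
  change (gapUniform.map (cdf gapUniform)).real (Iic a) =
    ((volume : Measure ℝ).restrict (Icc 0 1)).real (Iic a)
  rw [map_measureReal_apply hm measurableSet_Iic, measureReal_restrict_apply measurableSet_Iic]
  rcases lt_or_ge a 0 with h0 | h0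
  · have e1 : cdf gapUniform ⁻¹' Iic a = ∅ :=
      eq_empty_of_forall_notMem fun v hv => by
        have : cdf gapUniform v ≤ a := hv
        linarith [cdf_nonneg gapUniform v]
    have e2 : Iic a ∩ Icc 0 1 = ∅ :=
      eq_empty_of_forall_notMem fun v hv => by
        have : v ≤ a := hv.1
        linarith [hv.2.1]
    rw [e1, e2]
    simp
  rcases le_or_gt a 1 with h1 | h1
  · have e1 : gapUniform.real (cdf gapUniform ⁻¹' Iic a) =
        gapUniform.real (Iic (gapQuantile a)) := by
      refine measureReal_congr ?_
      filter_upwards [ae_gapUniform_mem] with v hv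
      refine propext ?_
      change cdf gapUniform v ≤ a ↔ v ≤ gapQuantile a
      rw [← gapQuantile_strictMono.le_iff_le, (gapQuantile_cdf_gapUniform hv).2]
    have e2 : Iic a ∩ Icc 0 1 = Icc 0 a := by
      ext v
      simp only [mem_inter_iff, mem_Iic, mem_Icc]
      exact ⟨fun h => ⟨h.2.1, h.1⟩, fun h => ⟨h.2, h.1, h.2.trans h1⟩⟩
    rw [e1, ← cdf_eq_real, cdf_gapUniform_gapQuantile ⟨h0, h1⟩, e2, Measure.real, Real.volume_Icc,
      ENNReal.toReal_ofReal (by linarith), sub_zero]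
  · have e1 : cdf gapUniform ⁻¹' Iic a = univ :=
      eq_univ_of_forall fun v => (cdf_le_one gapUniform v).trans h1.le
    have e2 : Iic a ∩ Icc 0 1 = Icc (0 : ℝ) 1 := inter_eq_right.2 fun v hv => hv.2.trans h1.le
    rw [e1, e2]
    simp [Measure.real]

namespace IsCandidateSequence

variable {Ω : Type*} [MeasurableSpace Ω] {P : Measure Ω} {θ U : ℕ → Ω → ℝ}

theorem isUniformSequence (h : IsCandidateSequence P gapUniform θ U) :
    IsUniformSequence P fun t ω => cdf gapUniform (θ t ω) where
  measurable t := (monotone_cdf gapUniform).measurable.comp (h.measurable_ability t)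
  law t := by
    rw [← map_cdf_gapUniform, ← h.law_ability t,
      Measure.map_map (monotone_cdf _).measurable (h.measurable_ability t)]
    rw [h.law_ability t]
    rfl
  indep := (h.indep.precomp Sum.inl_injective).comp (fun _ => cdf gapUniform)
    fun _ => (monotone_cdf gapUniform).measurable

theorem ae_mem (h : IsCandidateSequence P gapUniform θ U) :
    ∀ᵐ ω ∂P, ∀ t, θ t ω ∈ Icc (0 : ℝ) (1 / 4) ∪ Ioc (3 / 4) 1 := by
  rw [ae_all_iff]
  intro t
  refine ae_of_ae_map (h.measurable_ability t).aemeasurable ?_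
  rw [h.law_ability t]
  exact ae_gapUniform_mem

theorem regret_eq (h : IsCandidateSequence P gapUniform θ U) (T B : ℕ)
    {policy policy' : Ω → HiringRule} (hp : ∀ᵐ ω ∂P, policy ω = policy' ω) :
    regret P θ T B policy =
      ∫ ω, offlineValue (fun i => gapQuantile (cdf gapUniform (θ i ω))) T B ∂P -
        ∫ ω, onlineValue (fun i => gapQuantile (cdf gapUniform (θ i ω))) T B (policy' ω) ∂P := by
  unfold regret
  congr 1
  · refine integral_congr_ae ?_
    filter_upwards [h.ae_mem] with ω hω
    simp only [(gapQuantile_cdf_gapUniform (hω _)).2]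
  · refine integral_congr_ae ?_
    filter_upwards [h.ae_mem, hp] with ω hω hp
    simp only [(gapQuantile_cdf_gapUniform (hω _)).2, hp]

theorem gapUniformCwG_ae_eq (h : IsCandidateSequence P gapUniform θ U) (T B : ℕ) :
    ∀ᵐ ω ∂P, gapUniformCwG T B (fun t => θ t ω) (fun t => U t ω) =
      cwgQuantileRule T B fun t => cdf gapUniform (θ t ω) := by
  filter_upwards [h.ae_mem] with ω hω
  have h1 : cdf gapUniform (1 / 4) = 1 / 2 := by
    rw [cdf_gapUniform_low ⟨by norm_num, le_rfl⟩]; norm_num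
  simp only [gapUniformCwG, cwgPolicy, cwgQuantileRule, quantileSample_gapUniform (hω _), h1]

end IsCandidateSequence

theorem corollary2 :
    (∃ C : ℝ, ∀ T B : ℕ, 1 ≤ B → B ≤ T →
      ∀ (Ω : Type*) [MeasurableSpace Ω] (P : Measure Ω) [IsProbabilityMeasure P]
        (θ U : ℕ → Ω → ℝ), IsCandidateSequence P gapUniform θ U →
        regret P θ T B (fun ω => gapUniformCwG T B (fun t => θ t ω) (fun t => U t ω))
          ≤ C * Real.log T ^ 2) ∧
    (∃ c : ℝ, 0 < c ∧ ∃ T₀ : ℕ, ∀ T : ℕ, T₀ ≤ T → ∃ B : ℕ, 1 ≤ B ∧ B ≤ T ∧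
      ∀ (Ω : Type*) [MeasurableSpace Ω] (P : Measure Ω) [IsProbabilityMeasure P]
        (θ U : ℕ → Ω → ℝ), IsCandidateSequence P gapUniform θ U →
        c * √T ≤ regret P θ T B (fun ω => cePolicy gapUniform T (fun t => θ t ω))) := by
  refine ⟨⟨300, fun T B hB hBT Ω _ P _ θ U h => ?_⟩, 1 / 10 ^ 9, by norm_num, 180000,
    fun T hT => ⟨hardBudget T, (hardBudget_bounds hT).1, (hardBudget_bounds hT).2.1,
      fun Ω _ P _ θ U h => ?_⟩⟩
  · rw [h.regret_eq T B (h.gapUniformCwG_ae_eq T B)]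
    exact h.isUniformSequence.cwg_regret_le hB hBT
  · rw [h.regret_eq T _ (Filter.Eventually.of_forall fun ω => rfl)]
    exact h.isUniformSequence.ce_regret_ge hT
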